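/- **Theorem.** Let $n\in\{1,2,4,8\}$ (so that $n+2\in\{3,4,6,10\}$). *Setting.* A normed division algebra is a nonzero finite-dimensional, possibly nonassociative, unital real algebra $\mathbb K$ with a Euclidean norm such that $|ab|=|a||b|$; let $(\cdot,\cdot)$ be the inner product, $\mathrm{Re}(a)=(a,1)$ and $a^*=2\,\mathrm{Re}(a)1-a$. There is a normed division algebra of dimension $n$; let $\mathbb K$ be any such algebra. Let $V=\mathfrak h_2(\mathbb K)$ be the space of hermitian $2\times2$ matrices over $\mathbb K$, with the Minkowski metric $g$ of signature $(n+1,1)$ given by $g(A,A)=-\det A$, and let $S_+=\mathbb K^2$. Put $\tilde A=A-(\mathrm{tr}\,A)1$ and, for $\psi,\phi\in S_+$, $\psi\cdot\phi=\widetilde{\psi\phi^\dagger+\phi\psi^\dagger}\in V$. The Lorentz algebra $\mathfrak{so}(n+1,1)=\mathfrak{so}(V,g)$ acts on $S_+$ by the spin representation, in which the endomorphism $v\mapsto g(B,v)A-g(A,v)B$ acts as $\psi\mapsto\frac14\bigl(\tilde A(B\psi)-\tilde B(A\psi)\bigr)$. The Poincaré superalgebra is $$\mathfrak{siso}(n+1,1)=\mathfrak{so}(n+1,1)\ltimes(V\oplus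 S_+),$$ with even part $\mathfrak{so}(n+1,1)\oplus V$, odd part $S_+$, and bracket $$[(T,A,\psi),(T',A',\psi')]=([T,T'],\;TA'-T'A+\psi\cdot\psi',\;T\psi'-T'\psi).$$ Let $\alpha$ be the super-skew-symmetric trilinear form on $\mathfrak{siso}(n+1,1)$ with $\alpha(\psi,\phi,A)=g(\psi\cdot\phi,A)$ for $\psi,\phi\in S_+$, $A\in V$, which vanishes on all other types of triples (in particular when an argument lies in $\mathfrak{so}(n+1,1)$). *Claim.* $\dim V=n+2$, $g(\psi\cdot\phi,A)=\mathrm{Re}(\psi^\dagger(A\phi))$ for all $\psi,\phi\in S_+$ and $A\in V$, $\mathfrak{siso}(n+1,1)$ is a Lie superalgebra, and $\alpha$ is an even Chevalley–Eilenberg 3-cocycle on it with values in the trivial representation $\mathbb R$ which is not a coboundary. Extending $\mathfrak{siso}(n+1,1)$ by $\alpha$ gives a Lie 2-superalgebra (an $L_\infty$-superalgebra whose nonzero terms have degree $0$ or $1$), the superstring Lie 2-superalgebra $$\mathfrak{superstring}(n+1,1):\qquad \mathfrak{siso}(n+1,1)\xleftarrow{\;d=0\;}\mathbb R ,$$ with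 $\mathfrak{siso}(n+1,1)$ in degree $0$, the even line $\mathbb R$ in degree $1$, $l_1=d=0$, $l_2$ the bracket of $\mathfrak{siso}(n+1,1)$ (with $\mathbb R$ acted on trivially), $l_3=\alpha$ and $l_k=0$ for $k\ge4$. It sits in a short exact sequence of Lie 2-superalgebras $$0\to b\mathbb R\to\mathfrak{superstring}(n+1,1)\to\mathfrak{siso}(n+1,1)\to0,$$ where $b\mathbb R$ is the abelian Lie 2-superalgebra with $\mathbb R$ in degree $1$ and $\mathfrak{siso}(n+1,1)$ is placed in degree $0$. It is not exact. Here a Lie 2-superalgebra is called exact if $d=0$ and $l_3$, as a 3-cocycle on the Lie superalgebra of degree-$0$ elements with values in its representation $\rho(x)f=l_2(x,f)$ on the degree-$1$ elements, is a coboundary. -/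

import Mathlib

/-! ## Signs -/

/-- The sign `(-1)^p` of a parity `p`. -/
noncomputable def paritySign (p : ZMod 2) : ℝ := if p = 0 then 1 else -1

/-- The Koszul sign `ε(σ; x)`, defined by
`x₁ ⋯ xₙ = ε(σ; x) x_{σ(1)} ⋯ x_{σ(n)}` in the free graded-commutative algebra, for elements `xᵢ`
of grade `p i`: every inversion of `σ` contributes the sign of the transposition. -/
noncomputable def koszulSign {n : ℕ} (σ : Equiv.Perm (Fin n)) (p : Fin n → ZMod 2) : ℝ :=
  ∏ i, ∏ j, if i < j ∧ σ j < σ i then paritySign (p (σ i) * p (σ j)) else 1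

/-- The sign `χ(σ; x) = sgn(σ) ε(σ; x)`. -/
noncomputable def chiSign {n : ℕ} (σ : Equiv.Perm (Fin n)) (p : Fin n → ZMod 2) : ℝ :=
  ((Equiv.Perm.sign σ : ℤ) : ℝ) * koszulSign σ p

/-- The sign of moving the `i`-th of a list of elements of parities `p` to the front. -/
noncomputable def frontSign {n : ℕ} (p : Fin n → ZMod 2) (i : Fin n) : ℝ :=
  paritySign (p i * ∑ k ∈ Finset.Iio i, p k)

/-! ## Lie superalgebras and their cohomology -/

section Super

variable {E F : Type*} [AddCommGroup E] [Module ℝ E] [AddCommGroup F] [Module ℝ F]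

/-- A real super vector space `E = E₀ ⊕ E₁` with an even bilinear bracket which is
super-skew-symmetric and satisfies the super Jacobi identity. -/
structure IsLieSuperalgebra (𝒜 : ZMod 2 → Submodule ℝ E) (br : E →ₗ[ℝ] E →ₗ[ℝ] E) : Prop where
  isInternal : DirectSum.IsInternal 𝒜
  bracket_mem : ∀ {p q : ZMod 2} {x y : E}, x ∈ 𝒜 p → y ∈ 𝒜 q → br x y ∈ 𝒜 (p + q)
  skew : ∀ {p q : ZMod 2} {x y : E}, x ∈ 𝒜 p → y ∈ 𝒜 q →
    br x y = -(paritySign (p * q) • br y x)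
  jacobi : ∀ {p q : ZMod 2} {x y : E}, x ∈ 𝒜 p → y ∈ 𝒜 q → ∀ z : E,
    br x (br y z) = br (br x y) z + paritySign (p * q) • br y (br x z)

/-- `ω` is an `n`-cochain of parity `q` on the super vector space `(E, 𝒜)` with values in the super
vector space `(F, ℬ)`: a super-skew-symmetric `n`-linear map which preserves parity if `q = 0` and
reverses it if `q = 1`. -/
structure IsCochain {n : ℕ} (𝒜 : ZMod 2 → Submodule ℝ E) (ℬ : ZMod 2 → Submodule ℝ F)
    (q : ZMod 2) (ω : MultilinearMap ℝ (fun _ : Fin n => E) F) : Prop where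
  skew : ∀ (σ : Equiv.Perm (Fin n)) (p : Fin n → ZMod 2) (X : Fin n → E),
    (∀ i, X i ∈ 𝒜 (p i)) → ω (fun i => X (σ i)) = chiSign σ p • ω X
  parity : ∀ (p : Fin n → ZMod 2) (X : Fin n → E),
    (∀ i, X i ∈ 𝒜 (p i)) → ω X ∈ ℬ ((∑ i, p i) + q)

/-- The increasing enumeration of the indices different from `i` and `j`, where `i < j`. -/
def skipTwo {m : ℕ} (i j : Fin (m + 2)) (k : Fin m) : Fin (m + 2) :=
  if (k : ℕ) < i then ⟨k, by omega⟩
  else if (k : ℕ) + 1 < j then ⟨k + 1, by omega⟩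
  else ⟨k + 2, by omega⟩

/-- The Chevalley–Eilenberg coboundary `dω(X₁, …, Xₙ₊₁)` of an `n`-cochain `ω` of parity `q`, where
`n = m + 1`, evaluated at homogeneous elements `Xᵢ` of parity `p i`. Here `br` is the bracket and
`ρ` the action on the coefficients. Indices start at `0`. -/
noncomputable def ceDifferential {m : ℕ} (br : E → E → E) (ρ : E → F → F) (q : ZMod 2)
    (ω : (Fin (m + 1) → E) → F) (p : Fin (m + 2) → ZMod 2) (X : Fin (m + 2) → E) : F :=
  ∑ i : Fin (m + 2), ((-1) ^ (i : ℕ) * paritySign (p i * q) * frontSign p i) •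
      ρ (X i) (ω (fun k => X (i.succAbove k)))
  + ∑ i : Fin (m + 2), ∑ j ∈ Finset.Ioi i,
      ((-1) ^ ((i : ℕ) + (j : ℕ)) * paritySign (p i * p j) * frontSign p i * frontSign p j) •
        ω (Fin.cons (br (X i) (X j)) (fun k => X (skipTwo i j k)))

/-- The real line as a purely even super vector space. -/
def evenLine (p : ZMod 2) : Submodule ℝ ℝ := if p = 0 then ⊤ else ⊥

/-- `ω` is an even `(m+1)`-cocycle with values in the trivial representation `ℝ`. -/
def IsEvenCocycle {m : ℕ} (𝒜 : ZMod 2 → Submodule ℝ E) (br : E →ₗ[ℝ] E →ₗ[ℝ] E)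
    (ω : MultilinearMap ℝ (fun _ : Fin (m + 1) => E) ℝ) : Prop :=
  IsCochain 𝒜 evenLine 0 ω ∧
  ∀ (p : Fin (m + 2) → ZMod 2) (X : Fin (m + 2) → E), (∀ i, X i ∈ 𝒜 (p i)) →
    ceDifferential (fun x y => br x y) (fun _ _ => (0 : ℝ)) 0 ω p X = 0

/-- `ω` is an `(m+2)`-coboundary with values in the trivial representation `ℝ`: it is `dθ` for some
`(m+1)`-cochain `θ = θ₀ + θ₁`, where `θ₀` is even and `θ₁` is odd. -/
def IsCoboundary {m : ℕ} (𝒜 : ZMod 2 → Submodule ℝ E) (br : E →ₗ[ℝ] E →ₗ[ℝ] E)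
    (ω : MultilinearMap ℝ (fun _ : Fin (m + 2) => E) ℝ) : Prop :=
  ∃ θ₀ θ₁ : MultilinearMap ℝ (fun _ : Fin (m + 1) => E) ℝ,
    IsCochain 𝒜 evenLine 0 θ₀ ∧ IsCochain 𝒜 evenLine 1 θ₁ ∧
    ∀ (p : Fin (m + 2) → ZMod 2) (X : Fin (m + 2) → E), (∀ i, X i ∈ 𝒜 (p i)) →
      ω X = ceDifferential (fun x y => br x y) (fun _ _ => (0 : ℝ)) 0 θ₀ p X
        + ceDifferential (fun x y => br x y) (fun _ _ => (0 : ℝ)) 1 θ₁ p X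

end Super

/-! ## `L_∞`-superalgebras -/

/-- `σ` is an `(i, n - i)`-unshuffle: it is increasing on the first `i` indices and on the others. -/
def IsUnshuffle {n : ℕ} (i : ℕ) (σ : Equiv.Perm (Fin n)) : Prop :=
  ∀ a b : Fin n, a < b → ((b : ℕ) < i ∨ i ≤ (a : ℕ)) → σ a < σ b

/-- The data of an `L_∞`-superalgebra on the total space `E`: the subspaces of given degree (in `ℤ`)
and parity (in `ZMod 2`), and the `k`-ary brackets `l k`. -/
structure LInfinityData (E : Type*) [AddCommGroup E] [Module ℝ E] where
  grading : ℤ × ZMod 2 → Submodule ℝ E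
  l : (k : ℕ) → MultilinearMap ℝ (fun _ : Fin k => E) E

/-- The overall grade: degree plus parity. -/
def overallGrade (g : ℤ × ZMod 2) : ZMod 2 := (g.1 : ZMod 2) + g.2

namespace LInfinityData

variable {E : Type*} [AddCommGroup E] [Module ℝ E]

open Classical in
/-- The left-hand side of the generalized Jacobi identity in `n` arguments `xᵢ` of degree and parity
`g i`: the sum over `i + j = n + 1` with `i, j ≥ 1` and over `(i, n - i)`-unshuffles `σ` of
`χ(σ) (-1)^{i(j-1)} l_j(l_i(x_{σ(1)}, …, x_{σ(i)}), x_{σ(i+1)}, …, x_{σ(n)})`.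
The summation index `a` is `i - 1`. -/
noncomputable def jacobiator (L : LInfinityData E) {n : ℕ} (g : Fin n → ℤ × ZMod 2)
    (x : Fin n → E) : E :=
  ∑ a : Fin n, ∑ σ : Equiv.Perm (Fin n) with IsUnshuffle ((a : ℕ) + 1) σ,
    (chiSign σ (fun i => overallGrade (g i)) * (-1) ^ (((a : ℕ) + 1) * (n - ((a : ℕ) + 1)))) •
      L.l (n - ((a : ℕ) + 1) + 1)
        (Fin.cons
          (L.l ((a : ℕ) + 1) (fun b => x (σ ⟨b, by omega⟩)))
          (fun c => x (σ ⟨(a : ℕ) + 1 + c, by omega⟩)))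

/-- The laws of an `L_∞`-superalgebra. Degrees are non-negative, `l k` is defined for `k ≥ 1`
(so `l 0` is set to `0`), has degree `k - 2`, preserves parity, is graded antisymmetric, and the
generalized Jacobi identities hold. -/
structure IsLInfinitySuperalgebra (L : LInfinityData E) : Prop where
  isInternal : DirectSum.IsInternal L.grading
  nonneg : ∀ (d : ℤ) (p : ZMod 2), d < 0 → L.grading (d, p) = ⊥
  l_zero : L.l 0 = 0
  degree : ∀ (k : ℕ) (g : Fin k → ℤ × ZMod 2) (x : Fin k → E), (∀ i, x i ∈ L.grading (g i)) →
    L.l k x ∈ L.grading ((∑ i, (g i).1) + (k : ℤ) - 2, ∑ i, (g i).2)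
  skew : ∀ (k : ℕ) (σ : Equiv.Perm (Fin k)) (g : Fin k → ℤ × ZMod 2) (x : Fin k → E),
    (∀ i, x i ∈ L.grading (g i)) →
      L.l k (fun i => x (σ i)) = chiSign σ (fun i => overallGrade (g i)) • L.l k x
  jacobi : ∀ (n : ℕ) (g : Fin n → ℤ × ZMod 2) (x : Fin n → E),
    (∀ i, x i ∈ L.grading (g i)) → L.jacobiator g x = 0

/-- A Lie `n`-superalgebra: an `L_∞`-superalgebra whose nonzero terms all have degree `< n`. -/
def IsLieNSuperalgebra (n : ℕ) (L : LInfinityData E) : Prop :=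
  L.IsLInfinitySuperalgebra ∧ ∀ (d : ℤ) (p : ZMod 2), (n : ℤ) ≤ d → L.grading (d, p) = ⊥

/-- A Lie `(m+1)`-superalgebra is exact if only its terms `V₀` and `V_m` are nonzero, its
differential vanishes, and `l_{m+2}`, as a cochain on the Lie superalgebra `V₀` with values in the
representation `ρ(x)f = l₂(x, f)` of `V₀` on `V_m`, is the coboundary of a cochain `θ = θ₀ + θ₁`
(`θ₀` even, `θ₁` odd). A multilinear map on `V₀` is represented by one on the total space `E` whose
values outside `V₀` are irrelevant. -/
def IsExact (m : ℕ) (L : LInfinityData E) : Prop :=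
  (∀ (d : ℤ) (p : ZMod 2), d ≠ 0 → d ≠ m → L.grading (d, p) = ⊥) ∧
  L.l 1 = 0 ∧
  ∃ θ₀ θ₁ : MultilinearMap ℝ (fun _ : Fin (m + 1) => E) E,
    IsCochain (fun p => L.grading (0, p)) (fun p => L.grading (m, p)) 0 θ₀ ∧
    IsCochain (fun p => L.grading (0, p)) (fun p => L.grading (m, p)) 1 θ₁ ∧
    ∀ (p : Fin (m + 2) → ZMod 2) (X : Fin (m + 2) → E), (∀ i, X i ∈ L.grading (0, p i)) →
      L.l (m + 2) X
        = ceDifferential (fun x y => L.l 2 ![x, y]) (fun x f => L.l 2 ![x, f]) 0 θ₀ p X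
          + ceDifferential (fun x y => L.l 2 ![x, y]) (fun x f => L.l 2 ![x, f]) 1 θ₁ p X

/-- A (strict) homomorphism: a linear map preserving degree, parity and all brackets. -/
structure IsHom {E' : Type*} [AddCommGroup E'] [Module ℝ E'] (L : LInfinityData E)
    (L' : LInfinityData E') (f : E →ₗ[ℝ] E') : Prop where
  map_grading : ∀ (g : ℤ × ZMod 2) (x : E), x ∈ L.grading g → f x ∈ L'.grading g
  map_l : ∀ (k : ℕ) (x : Fin k → E), f (L.l k x) = L'.l k (fun i => f (x i))

/-- `0 → L' → L → L'' → 0` is a short exact sequence. -/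
structure IsShortExact {E' E'' : Type*} [AddCommGroup E'] [Module ℝ E'] [AddCommGroup E'']
    [Module ℝ E''] (L' : LInfinityData E') (L : LInfinityData E) (L'' : LInfinityData E'')
    (ι : E' →ₗ[ℝ] E) (π : E →ₗ[ℝ] E'') : Prop where
  isHom_left : IsHom L' L ι
  isHom_right : IsHom L L'' π
  injective : Function.Injective ι
  exact : Function.Exact ι π
  surjective : Function.Surjective π

end LInfinityData

section Extensions

variable {E : Type*} [AddCommGroup E] [Module ℝ E]

/-- A bilinear map as a multilinear map in two arguments. -/
def bilinToMultilinear (br : E →ₗ[ℝ] E →ₗ[ℝ] E) : MultilinearMap ℝ (fun _ : Fin 2 => E) E where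
  toFun v := br (v 0) (v 1)
  map_update_add' v i x y := by
    fin_cases i <;> simp [Function.update]
  map_update_smul' v i c x := by
    fin_cases i <;> simp [Function.update]

/-- A Lie superalgebra as an `L_∞`-superalgebra concentrated in degree `0`. -/
noncomputable def lieLInfinity (𝒜 : ZMod 2 → Submodule ℝ E) (br : E →ₗ[ℝ] E →ₗ[ℝ] E) :
    LInfinityData E where
  grading g := if g.1 = 0 then 𝒜 g.2 else ⊥
  l
    | 2 => bilinToMultilinear br
    | _ => 0

/-- The abelian `L_∞`-superalgebra `bℝ` with the even line `ℝ` in degree `1`. -/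
noncomputable def bLine : LInfinityData ℝ where
  grading g := if g.1 = 1 then evenLine g.2 else ⊥
  l _ := 0

/-- The extension of a Lie superalgebra `E` by a real-valued `3`-cochain `ω`: `E` in degree `0`, the
even line `ℝ` in degree `1`, zero differential, `l₂` the bracket of `E` (with `ℝ` acted on
trivially), `l₃ = ω`, and all other `l_k` zero. -/
noncomputable def cocycleExtension (𝒜 : ZMod 2 → Submodule ℝ E) (br : E →ₗ[ℝ] E →ₗ[ℝ] E)
    (ω : MultilinearMap ℝ (fun _ : Fin 3 => E) ℝ) : LInfinityData (E × ℝ) where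
  grading g :=
    if g.1 = 0 then (𝒜 g.2).prod ⊥ else if g.1 = 1 then (⊥ : Submodule ℝ E).prod (evenLine g.2)
    else ⊥
  l
    | 2 => (LinearMap.inl ℝ E ℝ).compMultilinearMap
        ((bilinToMultilinear br).compLinearMap fun _ => LinearMap.fst ℝ E ℝ)
    | 3 => (LinearMap.inr ℝ E ℝ).compMultilinearMap
        (ω.compLinearMap fun _ => LinearMap.fst ℝ E ℝ)
    | _ => 0

end Extensions

/-! ## Normed division algebras -/

/-- A normed division algebra: a nonzero finite-dimensional, possibly nonassociative, unital real
algebra with a Euclidean norm `|·|` such that `|ab| = |a||b|`. The norm is given by the positive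
definite quadratic form `normSq a = |a|²`. -/
class NormedDivisionAlgebra (K : Type*) extends NonAssocRing K, Module ℝ K, IsScalarTower ℝ K K,
    SMulCommClass ℝ K K, Module.Finite ℝ K, Nontrivial K where
  normSq : QuadraticForm ℝ K
  normSq_posDef : normSq.PosDef
  normSq_mul : ∀ a b : K, normSq (a * b) = normSq a * normSq b

namespace NormedDivisionAlgebra

variable {K : Type*} [NormedDivisionAlgebra K]

/-- The inner product `(a, b)` obtained by polarizing the norm. -/
noncomputable def ip : LinearMap.BilinForm ℝ K :=
  (1 / 2 : ℝ) • (normSq (K := K)).polarBilin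

/-- The real part of `a`, as a real number. -/
noncomputable def re : K →ₗ[ℝ] ℝ := (ip (K := K)).flip 1

theorem ip_apply (a b : K) :
    ip a b = (normSq (a + b) - normSq a - normSq b) / 2 := by
  simp [ip, QuadraticMap.polar]; ring

theorem re_apply (a : K) : re a = ip a 1 := rfl

theorem ip_comm (a b : K) : ip a b = ip b a := by
  rw [ip_apply, ip_apply, add_comm a b]; ring

theorem ip_self (a : K) : ip a a = normSq a := by
  rw [ip_apply, ← two_smul ℝ a, QuadraticMap.map_smul]; simp; ring

theorem normSq_add (a b : K) : normSq (a + b) = normSq a + normSq b + 2 * ip a b := by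
  rw [ip_apply]; ring

theorem ip_ext {a b : K} (h : ∀ c, ip a c = ip b c) : a = b := by
  by_contra hne
  have h1 := normSq_posDef (K := K) (a - b) (sub_ne_zero.mpr hne)
  rw [← ip_self] at h1
  have : ip (a - b) (a - b) = 0 := by
    rw [ip_comm, map_sub, ip_comm _ a, ip_comm _ b, h, sub_self]
  linarith

theorem normSq_one : normSq (1 : K) = 1 := by
  have h := normSq_mul (1 : K) 1
  have h0 := normSq_posDef (K := K) 1 one_ne_zero
  rw [mul_one] at h
  nlinarith

theorem ip_mul_left (a b c : K) : ip (a * b) (a * c) = normSq a * ip b c := by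
  have h := normSq_mul a (b + c)
  rw [mul_add, normSq_add, normSq_add, normSq_mul, normSq_mul] at h
  linarith

theorem ip_mul_mul (a b c d : K) :
    ip (a * b) (c * d) + ip (a * d) (c * b) = 2 * ip a c * ip b d := by
  have h := ip_mul_left (a + c) b d
  simp only [add_mul, map_add, LinearMap.add_apply, ip_mul_left, normSq_add] at h
  rw [ip_comm (c * b)] at h
  linarith

/-- Conjugation `a* = 2 Re(a) - a`: it fixes the line `ℝ1` and is `-1` on its orthogonal
complement. -/
noncomputable def conj (a : K) : K := (2 * re a) • (1 : K) - a

theorem ip_mul_eq_left (a b d : K) : ip (a * b) d = ip b (conj a * d) := by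
  have h := ip_mul_mul a b 1 d
  simp only [one_mul] at h
  rw [conj, sub_mul, smul_mul_assoc, one_mul, map_sub, map_smul, re_apply, smul_eq_mul,
    ip_comm b (a * d)]
  linarith

theorem ip_mul_eq_right (a b c : K) : ip (a * b) c = ip a (c * conj b) := by
  have h := ip_mul_mul a b c 1
  simp only [mul_one] at h
  rw [conj, mul_sub, mul_smul_comm, mul_one, map_sub, map_smul, re_apply, smul_eq_mul]
  linarith

theorem re_one : re (1 : K) = 1 := by rw [re_apply, ip_self, normSq_one]

theorem conj_conj (a : K) : conj (conj a) = a := by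
  simp only [conj, map_sub, map_smul, re_one, smul_eq_mul, mul_one]
  module

theorem conj_add (a b : K) : conj (a + b) = conj a + conj b := by
  simp only [conj, map_add]; module

theorem conj_smul (r : ℝ) (a : K) : conj (r • a) = r • conj a := by
  simp only [conj, map_smul, smul_eq_mul]; module

theorem conj_one : conj (1 : K) = 1 := by
  simp only [conj, re_one]; module

theorem re_mul (a b : K) : re (a * b) = ip a (conj b) := by
  rw [re_apply, ip_mul_eq_right, one_mul]

theorem conj_mul (a b : K) : conj (a * b) = conj b * conj a := by
  refine ip_ext fun c => ?_
  have h1 : ip (conj (a * b)) c = ip (conj a) (b * c) := by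
    have e1 : ip (conj (a * b)) c = ip (a * b) (conj c) := by
      have := ip_mul_eq_left (a * b) c 1
      rw [mul_one, ip_comm c] at this
      rw [← this, ip_mul_eq_right, one_mul]
    rw [e1, ip_mul_eq_left, ip_comm, ip_mul_eq_right, conj_conj]
  rw [h1, ip_mul_eq_left, conj_conj]

noncomputable instance : StarRing K where
  star := conj
  star_involutive := conj_conj
  star_mul := conj_mul
  star_add := conj_add

theorem star_eq_conj (a : K) : star a = conj a := rfl

instance : StarModule ℝ K where
  star_smul r a := by simp [star_eq_conj, conj_smul]

theorem re_star (a : K) : re (star a) = re a := by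
  simp only [star_eq_conj, conj, map_sub, map_smul, re_one, smul_eq_mul]; ring

theorem re_mul_star (a b : K) : re (a * star b) = ip a b := by
  rw [re_mul, star_eq_conj, conj_conj]

theorem eq_re_smul_of_star_eq {a : K} (h : star a = a) : a = re a • (1 : K) := by
  rw [star_eq_conj, conj, sub_eq_iff_eq_add, ← two_smul ℝ a, mul_smul] at h
  exact (smul_right_injective K (two_ne_zero (α := ℝ)) h).symm

end NormedDivisionAlgebra

/-! ## Vectors, spinors and the Poincaré superalgebra -/

namespace Superstring

open NormedDivisionAlgebra Matrix

variable (K : Type*) [NormedDivisionAlgebra K]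

/-- The space `V = 𝔥₂(K)` of hermitian `2 × 2` matrices. -/
def hermitianMatrices : Submodule ℝ (Matrix (Fin 2) (Fin 2) K) where
  carrier := {A | A.IsHermitian}
  add_mem' hA hB := hA.add hB
  zero_mem' := Matrix.isHermitian_zero
  smul_mem' r A hA := by
    change Aᴴ = A at hA
    change (r • A)ᴴ = r • A
    rw [Matrix.conjTranspose_smul, hA]; simp

/-- Vectors: the elements of `𝔥₂(K)`. -/
def Vec : Type _ := hermitianMatrices K

noncomputable instance : AddCommGroup (Vec K) :=
  inferInstanceAs (AddCommGroup (hermitianMatrices K))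

noncomputable instance : Module ℝ (Vec K) :=
  inferInstanceAs (Module ℝ (hermitianMatrices K))

instance : Module.Finite ℝ (Vec K) :=
  inferInstanceAs (Module.Finite ℝ (hermitianMatrices K))

/-- The space `S₊ = K²` of spinors. -/
abbrev Spinor : Type _ := Fin 2 → K

variable {K}

theorem Vec.ext {A B : Vec K} (h : A.1 = B.1) : A = B := Subtype.ext h

@[simp] theorem Vec.add_val (A B : Vec K) : (A + B).1 = A.1 + B.1 := rfl

@[simp] theorem Vec.smul_val (c : ℝ) (A : Vec K) : (c • A).1 = c • A.1 := rfl

theorem Vec.star_apply (A : Vec K) (i j : Fin 2) : star (A.1 i j) = A.1 j i :=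
  A.2.apply j i

/-- The Minkowski metric: the polarization of `A ↦ -det A`, where
`det A = A₁₁A₂₂ - A₁₂A₂₁ ∈ ℝ1`. -/
noncomputable def minkowski : LinearMap.BilinForm ℝ (Vec K) :=
  LinearMap.mk₂ ℝ
    (fun A B => -(1 / 2 : ℝ) * re (A.1 0 0 * B.1 1 1 + B.1 0 0 * A.1 1 1
      - A.1 0 1 * B.1 1 0 - B.1 0 1 * A.1 1 0))
    (fun A A' B => by simp [add_mul, mul_add]; ring)
    (fun c A B => by simp [smul_mul_assoc, mul_smul_comm]; ring)
    (fun A B B' => by simp [add_mul, mul_add]; ring)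
    (fun c A B => by simp [smul_mul_assoc, mul_smul_comm]; ring)

theorem minkowski_apply (A B : Vec K) :
    minkowski A B = -(1 / 2 : ℝ) * re (A.1 0 0 * B.1 1 1 + B.1 0 0 * A.1 1 1
      - A.1 0 1 * B.1 1 0 - B.1 0 1 * A.1 1 0) := rfl

/-- The vector with rows `(a, y)` and `(y*, d)`. -/
noncomputable def mkVec (a d : ℝ) (y : K) : Vec K :=
  ⟨!![a • (1 : K), y; star y, d • (1 : K)], by
    change Matrix.IsHermitian _
    ext i j; fin_cases i <;> fin_cases j <;> simp⟩

/-- The metric has signature `(n+1, 1)`. -/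
theorem minkowski_mkVec (t x : ℝ) (y : K) :
    minkowski (mkVec (t + x) (t - x) y) (mkVec (t + x) (t - x) y)
      = -t ^ 2 + x ^ 2 + normSq y := by
  rw [minkowski_apply]
  simp [mkVec, re_mul_star, ip_self, re_one]; ring

theorem minkowski_nondegenerate : (minkowski (K := K)).Nondegenerate := by
  have hsymm : ∀ A B : Vec K, minkowski A B = minkowski B A := by
    intro A B
    rw [minkowski_apply, minkowski_apply]
    congr 2; abel
  have key : ∀ A : Vec K, (∀ B, minkowski A B = 0) → A = 0 := by
    intro A hA
    have e0 := eq_re_smul_of_star_eq (A.star_apply 0 0)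
    have e1 := eq_re_smul_of_star_eq (A.star_apply 1 1)
    have h := hA (mkVec (-re (A.1 1 1)) (-re (A.1 0 0)) (A.1 0 1))
    rw [minkowski_apply, ← A.star_apply 0 1] at h
    simp only [mkVec, Matrix.of_apply, Matrix.cons_val', Matrix.cons_val_zero,
      Matrix.cons_val_one, Matrix.cons_val_fin_one, mul_smul_comm, smul_mul_assoc, mul_one,
      one_mul, map_add, map_sub, map_smul, smul_eq_mul, re_mul_star, ip_self] at h
    have hy : A.1 0 1 = 0 := by
      by_contra hne
      have := normSq_posDef (K := K) _ hne
      nlinarith [sq_nonneg (re (A.1 0 0)), sq_nonneg (re (A.1 1 1))]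
    rw [hy, map_zero] at h
    have h00 : re (A.1 0 0) = 0 := by
      nlinarith [sq_nonneg (re (A.1 0 0)), sq_nonneg (re (A.1 1 1))]
    have h11 : re (A.1 1 1) = 0 := by
      nlinarith [sq_nonneg (re (A.1 0 0)), sq_nonneg (re (A.1 1 1))]
    rw [h00, zero_smul] at e0
    rw [h11, zero_smul] at e1
    have h10 : A.1 1 0 = 0 := by rw [← A.star_apply 0 1, hy, star_zero]
    apply Subtype.ext
    ext i j
    fin_cases i <;> fin_cases j
    · exact e0
    · exact hy
    · exact h10
    · exact e1
  exact ⟨key, fun B hB => key B fun A => by rw [hsymm]; exact hB A⟩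

/-- The trace reversal `Ã = A - (tr A) 1`. -/
noncomputable def traceReversal (A : Matrix (Fin 2) (Fin 2) K) : Matrix (Fin 2) (Fin 2) K :=
  A - Matrix.diagonal fun _ => A.trace

theorem traceReversal_isHermitian {A : Matrix (Fin 2) (Fin 2) K} (hA : A.IsHermitian) :
    (traceReversal A).IsHermitian := by
  refine hA.sub ?_
  rw [Matrix.IsHermitian, Matrix.diagonal_conjTranspose]
  congr 1
  funext i
  rw [Pi.star_apply, ← Matrix.trace_conjTranspose, hA]

/-- The action of vectors `γ : V → Hom(S₊, S₋)`, `γ(A)ψ = Aψ`. -/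
noncomputable def gamma : Vec K →ₗ[ℝ] Spinor K →ₗ[ℝ] Spinor K :=
  LinearMap.mk₂ ℝ (fun A ψ => A.1 *ᵥ ψ)
    (fun _ _ _ => Matrix.add_mulVec _ _ _)
    (fun _ _ _ => Matrix.smul_mulVec _ _ _)
    (fun _ _ _ => Matrix.mulVec_add _ _ _)
    (fun _ _ _ => Matrix.mulVec_smul _ _ _)

/-- The action of vectors `γ̃ : V → Hom(S₋, S₊)`, `γ̃(A)ψ = Ãψ`. -/
noncomputable def gammaTilde : Vec K →ₗ[ℝ] Spinor K →ₗ[ℝ] Spinor K :=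
  LinearMap.mk₂ ℝ (fun A ψ => traceReversal A.1 *ᵥ ψ)
    (fun A A' ψ => by
      rw [← Matrix.add_mulVec]; congr 1
      ext i j; fin_cases i <;> fin_cases j <;> simp [traceReversal, Matrix.trace] <;> abel)
    (fun c A ψ => by
      rw [← Matrix.smul_mulVec]; congr 1
      ext i j; fin_cases i <;> fin_cases j <;> simp [traceReversal, Matrix.trace])
    (fun _ _ _ => Matrix.mulVec_add _ _ _)
    (fun _ _ _ => Matrix.mulVec_smul _ _ _)

/-- The pairing `⟨ψ, φ⟩ = Re(ψ†φ)` of `S₊` with `S₋`. -/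
noncomputable def pairing (ψ φ : Spinor K) : ℝ := re (star ψ ⬝ᵥ φ)

/-- The bracket of spinors as a function: `ψ · φ` is the trace reversal of `ψφ† + φψ†`. -/
noncomputable def spinorDotFun (ψ φ : Spinor K) : Vec K :=
  ⟨traceReversal (vecMulVec ψ (star φ) + vecMulVec φ (star ψ)),
    traceReversal_isHermitian (by ext i j; simp [vecMulVec_apply, add_comm])⟩

theorem spinorDotFun_val (ψ φ : Spinor K) :
    (spinorDotFun ψ φ).1 = traceReversal (vecMulVec ψ (star φ) + vecMulVec φ (star ψ)) := rfl

/-- The bracket of spinors `(ψ, φ) ↦ ψ · φ` as a bilinear map `S₊ × S₊ → V`. -/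
noncomputable def spinorDot : Spinor K →ₗ[ℝ] Spinor K →ₗ[ℝ] Vec K :=
  LinearMap.mk₂ ℝ spinorDotFun
    (fun ψ ψ' φ => by
      apply Vec.ext; rw [Vec.add_val]; ext i j
      fin_cases i <;> fin_cases j <;>
        simp [spinorDotFun_val, traceReversal, Matrix.trace, vecMulVec_apply, add_mul, mul_add] <;>
        abel)
    (fun c ψ φ => by
      apply Vec.ext; rw [Vec.smul_val]; ext i j
      fin_cases i <;> fin_cases j <;>
        simp [spinorDotFun_val, traceReversal, Matrix.trace, vecMulVec_apply])
    (fun ψ φ φ' => by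
      apply Vec.ext; rw [Vec.add_val]; ext i j
      fin_cases i <;> fin_cases j <;>
        simp [spinorDotFun_val, traceReversal, Matrix.trace, vecMulVec_apply, add_mul, mul_add] <;>
        abel)
    (fun c ψ φ => by
      apply Vec.ext; rw [Vec.smul_val]; ext i j
      fin_cases i <;> fin_cases j <;>
        simp [spinorDotFun_val, traceReversal, Matrix.trace, vecMulVec_apply])

variable (K) in
/-- The Lorentz algebra `𝔰𝔬(n+1, 1)`: the endomorphisms of `V` that are skew for the metric. -/
noncomputable def lorentzAlgebra : Submodule ℝ (Module.End ℝ (Vec K)) :=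
  (minkowski (K := K)).skewAdjointSubmodule

variable (K) in
/-- The underlying space of the Lorentz algebra. -/
abbrev Lorentz : Type _ := lorentzAlgebra K

/-- The commutator of two elements of the Lorentz algebra. -/
noncomputable def lorentzBracket (T T' : Lorentz K) : Lorentz K :=
  ⟨⁅T.1, T'.1⁆, LinearMap.BilinForm.isSkewAdjoint_bracket _ T.2 T'.2⟩

/-- The spin representation of the Lorentz algebra on `S₊`: the endomorphism `T` corresponds to the
element `¼ ∑ᵢ T(eᵢ) eⁱ` of the Clifford algebra of `(V, g)`, where `(eᵢ)` is a basis of `V` and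
`(eⁱ)` its dual basis with respect to `g`, and a product `AB` of two vectors acts on `S₊` as
`γ̃(A) γ(B)`. So `v ↦ g(B, v)A - g(A, v)B` acts as `¼(γ̃(A)γ(B) - γ̃(B)γ(A))`. -/
noncomputable def spinAction : Lorentz K →ₗ[ℝ] Spinor K →ₗ[ℝ] Spinor K :=
  (1 / 4 : ℝ) • ∑ i,
    (LinearMap.lcomp ℝ (Spinor K)
        (gamma (minkowski.dualBasis minkowski_nondegenerate (Module.finBasis ℝ (Vec K)) i)))
      ∘ₗ gammaTilde
      ∘ₗ LinearMap.applyₗ (Module.finBasis ℝ (Vec K) i)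
      ∘ₗ (lorentzAlgebra K).subtype

variable (K) in
/-- The underlying space of the Poincaré superalgebra `𝔰𝔦𝔰𝔬(n+1, 1) = 𝔰𝔬(n+1, 1) ⋉ (V ⊕ S₊)`. -/
abbrev Siso : Type _ := Lorentz K × Vec K × Spinor K

variable (K) in
/-- The even part is `𝔰𝔬(n+1, 1) ⊕ V`, the odd part is `S₊`. -/
noncomputable def sisoGrading (p : ZMod 2) : Submodule ℝ (Siso K) :=
  if p = 0 then (⊤ : Submodule ℝ (Lorentz K)).prod ((⊤ : Submodule ℝ (Vec K)).prod ⊥)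
  else (⊥ : Submodule ℝ (Lorentz K)).prod ((⊥ : Submodule ℝ (Vec K)).prod ⊤)

variable (K) in
/-- The bracket of the semidirect product
`[(T, A, ψ), (T', A', ψ')] = ([T, T'], T A' - T' A + ψ · ψ', T ψ' - T' ψ)`. -/
noncomputable def sisoBracket : Siso K →ₗ[ℝ] Siso K →ₗ[ℝ] Siso K :=
  LinearMap.mk₂ ℝ
    (fun x y => (lorentzBracket x.1 y.1, x.1.1 y.2.1 - y.1.1 x.2.1 + spinorDot x.2.2 y.2.2,
      spinAction x.1 y.2.2 - spinAction y.1 x.2.2))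
    (fun x x' y => by
      refine Prod.ext (Subtype.ext ?_) (Prod.ext ?_ ?_)
      · simp [lorentzBracket, Ring.lie_def, add_mul, mul_add]; abel
      · simp; abel
      · simp; abel)
    (fun c x y => by
      refine Prod.ext (Subtype.ext ?_) (Prod.ext ?_ ?_)
      · simp [lorentzBracket, Ring.lie_def, smul_sub]
      · simp [smul_add, smul_sub]
      · simp [smul_sub])
    (fun x y y' => by
      refine Prod.ext (Subtype.ext ?_) (Prod.ext ?_ ?_)
      · simp [lorentzBracket, Ring.lie_def, add_mul, mul_add]; abel
      · simp; abel
      · simp; abel)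
    (fun c x y => by
      refine Prod.ext (Subtype.ext ?_) (Prod.ext ?_ ?_)
      · simp [lorentzBracket, Ring.lie_def, smul_sub]
      · simp [smul_add, smul_sub]
      · simp [smul_sub])

variable (K) in
/-- The super-skew-symmetric trilinear form with `α(ψ, φ, A) = g(ψ · φ, A)` for spinors `ψ, φ` and
a vector `A`, which vanishes on all other kinds of triples, in particular when some argument lies
in the Lorentz algebra. -/
noncomputable def alpha : MultilinearMap ℝ (fun _ : Fin 3 => Siso K) ℝ where
  toFun x := minkowski (spinorDot (x 0).2.2 (x 1).2.2) (x 2).2.1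
    - minkowski (spinorDot (x 0).2.2 (x 2).2.2) (x 1).2.1
    + minkowski (spinorDot (x 1).2.2 (x 2).2.2) (x 0).2.1
  map_update_add' {inst} v i x y := by
    obtain rfl : inst = instDecidableEqFin 3 := Subsingleton.elim _ _
    fin_cases i <;> simp [Function.update] <;> ring
  map_update_smul' {inst} v i c x := by
    obtain rfl : inst = instDecidableEqFin 3 := Subsingleton.elim _ _
    fin_cases i <;> simp [Function.update] <;> ring

variable (K) in
/-- The superstring Lie 2-superalgebra `𝔰𝔲𝔭𝔢𝔯𝔰𝔱𝔯𝔦𝔫𝔤(n+1, 1)`. -/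
noncomputable def superstring : LInfinityData (Siso K × ℝ) :=
  cocycleExtension (sisoGrading K) (sisoBracket K) (alpha K)

end Superstring

/-! ### Signs -/

/-! Two identities of normed division algebras carry the geometry. Both follow from polarizing `|ab|
= |a||b|` and from the fact that multiplication by `a*` is adjoint to multiplication by `a`. The
first, `star_mul_mul_add` and its mirror `mul_star_mul_add`, is a polarized alternative law on the
left; it gives the Clifford relations `γ̃(A)γ(B) + γ̃(B)γ(A) = 2g(A,B)`. The second,
`mul_star_mul_self`, is the alternative law on the right; it gives `(ψ·ψ)ψ = 0` for every spinor,
with polarized form `gamma_spinorDot_cyclic`.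

From the Clifford relations, `γ` intertwines the actions of the Lorentz algebra on the two spinor
spaces, so the spin action is a representation (`spinAction_lorentzBracket`) and `ψ·φ` is
equivariant (`apply_spinorDot`). The super Jacobi identity uses nothing more: on three spinors it is
trivial, because vectors and spinors commute.

The cocycle condition for `alpha` has content on two kinds of quadruples. With two even entries and
two spinors it is the Lorentz invariance of `g(ψ·φ, A)`. With four spinors it is
`minkowski_spinorDot_cyclic`, obtained by pairing the three-spinor identity with a fourth spinor. It
is not a coboundary: for `A = ψ·φ` any `dθ(ψ, φ, A)` is a multiple of `θ(A, A)`, which is zero by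
skewness, whereas `α(ψ, φ, A) = g(A, A)` can be made `1`.

The passage to Lie 2-superalgebras is formal. With `d = 0` only two generalized Jacobi identities
survive: for three arguments the super Jacobi identity, for four arguments `dω = 0`. Projecting a
trivialization of `l₃` to the real line gives a primitive of the cocycle, so an exact extension
would make `alpha` a coboundary. -/

theorem paritySign_zero : paritySign 0 = 1 := if_pos rfl

theorem paritySign_one : paritySign 1 = -1 := if_neg (by decide)

theorem parity_cases (p : ZMod 2) : p = 0 ∨ p = 1 := by revert p; decide

theorem paritySign_add (p q : ZMod 2) : paritySign (p + q) = paritySign p * paritySign q := by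
  rcases parity_cases p with rfl | rfl <;> rcases parity_cases q with rfl | rfl <;>
    simp [paritySign, show (1 : ZMod 2) + 1 = 0 from by decide]

theorem paritySign_mul_self (p : ZMod 2) : paritySign p * paritySign p = 1 := by
  unfold paritySign; split_ifs <;> norm_num

theorem perm_fin_two_eq (σ : Equiv.Perm (Fin 2)) : σ = 1 ∨ σ = Equiv.swap 0 1 := by
  revert σ; decide

theorem perm_fin_three_eq (σ : Equiv.Perm (Fin 3)) :
    σ = 1 ∨ σ = Equiv.swap 0 1 ∨ σ = Equiv.swap 1 2 ∨ σ = Equiv.swap 0 2 ∨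
      σ = Equiv.swap 0 1 * Equiv.swap 1 2 ∨ σ = Equiv.swap 1 2 * Equiv.swap 0 1 := by
  revert σ; decide

open Classical in
theorem unshuffles_two_one :
    (Finset.univ.filter fun σ : Equiv.Perm (Fin 3) => IsUnshuffle 2 σ) =
      {1, Equiv.swap 1 2, Equiv.swap 0 1 * Equiv.swap 1 2} := by
  -- With `IsUnshuffle` unfolded the condition is decidable, so the enumeration is a finite check;
  -- `convert` then reconciles it with the classical decidability instance of the filter.
  have h : ∀ σ : Equiv.Perm (Fin 3), (∀ a b : Fin 3, a < b → ((b : ℕ) < 2 ∨ 2 ≤ (a : ℕ)) →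
      σ a < σ b) ↔ σ ∈ ({1, Equiv.swap 1 2, Equiv.swap 0 1 * Equiv.swap 1 2} :
        Finset (Equiv.Perm (Fin 3))) := by decide
  ext σ
  rw [Finset.mem_filter]
  simp only [Finset.mem_univ, true_and]
  convert h σ
  exact Iff.rfl

-- The six permutations are listed by their first two values, in the order 01, 02, 03, 12, 13, 23.
-- This is also the order of the terms in `ceDifferential_three`.
open Classical in
theorem unshuffles_two_two :
    (Finset.univ.filter fun σ : Equiv.Perm (Fin 4) => IsUnshuffle 2 σ) =
      {1, Equiv.swap 1 2, Equiv.swap 1 3 * Equiv.swap 2 3, Equiv.swap 0 1 * Equiv.swap 1 2,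
        Equiv.swap 0 1 * Equiv.swap 1 3 * Equiv.swap 2 3, Equiv.swap 0 2 * Equiv.swap 1 3} := by
  have h : ∀ σ : Equiv.Perm (Fin 4), (∀ a b : Fin 4, a < b → ((b : ℕ) < 2 ∨ 2 ≤ (a : ℕ)) →
      σ a < σ b) ↔ σ ∈ ({1, Equiv.swap 1 2, Equiv.swap 1 3 * Equiv.swap 2 3,
        Equiv.swap 0 1 * Equiv.swap 1 2, Equiv.swap 0 1 * Equiv.swap 1 3 * Equiv.swap 2 3,
        Equiv.swap 0 2 * Equiv.swap 1 3} : Finset (Equiv.Perm (Fin 4))) := by decide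
  ext σ
  rw [Finset.mem_filter]
  simp only [Finset.mem_univ, true_and]
  convert h σ
  exact Iff.rfl

open Classical in
theorem sum_unshuffles_two_one {M : Type*} [AddCommMonoid M] (f : Equiv.Perm (Fin 3) → M) :
    ∑ σ : Equiv.Perm (Fin 3) with IsUnshuffle 2 σ, f σ =
      f 1 + f (Equiv.swap 1 2) + f (Equiv.swap 0 1 * Equiv.swap 1 2) := by
  rw [unshuffles_two_one, Finset.sum_insert, Finset.sum_insert, Finset.sum_singleton, add_assoc]
  all_goals
    simp only [Finset.mem_insert, Finset.mem_singleton]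
    decide

open Classical in
theorem sum_unshuffles_two_two {M : Type*} [AddCommMonoid M] (f : Equiv.Perm (Fin 4) → M) :
    ∑ σ : Equiv.Perm (Fin 4) with IsUnshuffle 2 σ, f σ =
      f 1 + f (Equiv.swap 1 2) + f (Equiv.swap 1 3 * Equiv.swap 2 3)
        + f (Equiv.swap 0 1 * Equiv.swap 1 2)
        + f (Equiv.swap 0 1 * Equiv.swap 1 3 * Equiv.swap 2 3)
        + f (Equiv.swap 0 2 * Equiv.swap 1 3) := by
  rw [unshuffles_two_two, Finset.sum_insert, Finset.sum_insert, Finset.sum_insert,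
    Finset.sum_insert, Finset.sum_insert, Finset.sum_singleton]
  · simp only [add_assoc]
  all_goals
    simp only [Finset.mem_insert, Finset.mem_singleton]
    decide

theorem koszulSign_one {n : ℕ} (p : Fin n → ZMod 2) : koszulSign 1 p = 1 := by
  refine Finset.prod_eq_one fun i _ => Finset.prod_eq_one fun j _ => if_neg ?_
  rintro ⟨h, h'⟩
  exact lt_asymm h h'

theorem chiSign_one {n : ℕ} (p : Fin n → ZMod 2) : chiSign 1 p = 1 := by
  simp [chiSign, koszulSign_one]

theorem chiSign_swap_fin_two (p : Fin 2 → ZMod 2) :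
    chiSign (Equiv.swap 0 1) p = -paritySign (p 0 * p 1) := by
  rw [chiSign, Equiv.Perm.sign_swap (by decide)]
  simp [koszulSign, Fin.prod_univ_two, mul_comm]

theorem chiSign_swap_one_two (p : Fin 3 → ZMod 2) :
    chiSign (Equiv.swap 1 2) p = -paritySign (p 1 * p 2) := by
  rw [chiSign, Equiv.Perm.sign_swap (by decide)]
  simp [koszulSign, Fin.prod_univ_three, mul_comm, Equiv.swap_apply_def]

theorem chiSign_cycle_fin_three (p : Fin 3 → ZMod 2) :
    chiSign (Equiv.swap 0 1 * Equiv.swap 1 2) p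
      = paritySign (p 0 * p 1) * paritySign (p 0 * p 2) := by
  rw [chiSign, Equiv.Perm.sign_mul, Equiv.Perm.sign_swap (by decide),
    Equiv.Perm.sign_swap (by decide)]
  simp [koszulSign, Fin.prod_univ_three, mul_comm, Equiv.swap_apply_def]

theorem chiSign_swap_one_two_fin_four (p : Fin 4 → ZMod 2) :
    chiSign (Equiv.swap 1 2) p = -paritySign (p 1 * p 2) := by
  rw [chiSign, Equiv.Perm.sign_swap (by decide)]
  simp [koszulSign, Fin.prod_univ_four, mul_comm, Equiv.swap_apply_def]

theorem chiSign_unshuffle_zero_three (p : Fin 4 → ZMod 2) :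
    chiSign (Equiv.swap 1 3 * Equiv.swap 2 3) p
      = paritySign (p 1 * p 3) * paritySign (p 2 * p 3) := by
  rw [chiSign, Equiv.Perm.sign_mul, Equiv.Perm.sign_swap (by decide),
    Equiv.Perm.sign_swap (by decide)]
  simp [koszulSign, Fin.prod_univ_four, mul_comm, Equiv.swap_apply_def]

theorem chiSign_unshuffle_one_two (p : Fin 4 → ZMod 2) :
    chiSign (Equiv.swap 0 1 * Equiv.swap 1 2) p
      = paritySign (p 0 * p 1) * paritySign (p 0 * p 2) := by
  rw [chiSign, Equiv.Perm.sign_mul, Equiv.Perm.sign_swap (by decide),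
    Equiv.Perm.sign_swap (by decide)]
  simp [koszulSign, Fin.prod_univ_four, mul_comm, Equiv.swap_apply_def]

theorem chiSign_unshuffle_one_three (p : Fin 4 → ZMod 2) :
    chiSign (Equiv.swap 0 1 * Equiv.swap 1 3 * Equiv.swap 2 3) p
      = -(paritySign (p 0 * p 1) * paritySign (p 0 * p 3) * paritySign (p 2 * p 3)) := by
  rw [chiSign, Equiv.Perm.sign_mul, Equiv.Perm.sign_mul, Equiv.Perm.sign_swap (by decide),
    Equiv.Perm.sign_swap (by decide), Equiv.Perm.sign_swap (by decide)]
  simp [koszulSign, Fin.prod_univ_four, Equiv.swap_apply_def, mul_comm (p 1) (p 0),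
    mul_comm (p 3) (p 0), mul_comm (p 3) (p 2), mul_assoc]

theorem chiSign_unshuffle_two_three (p : Fin 4 → ZMod 2) :
    chiSign (Equiv.swap 0 2 * Equiv.swap 1 3) p
      = paritySign (p 0 * p 2) * paritySign (p 0 * p 3) * paritySign (p 1 * p 2)
        * paritySign (p 1 * p 3) := by
  rw [chiSign, Equiv.Perm.sign_mul, Equiv.Perm.sign_swap (by decide),
    Equiv.Perm.sign_swap (by decide)]
  simp [koszulSign, Fin.prod_univ_four, Equiv.swap_apply_def, mul_comm (p 2) (p 0),
    mul_comm (p 3) (p 0), mul_comm (p 2) (p 1), mul_comm (p 3) (p 1)]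
  ring

/-! ### The Chevalley–Eilenberg differential in low degrees -/

section LowDegree

variable {E F : Type*} [AddCommGroup F] [Module ℝ F]

/-- For the zero action only bracket terms remain, and squares of signs cancel in their
coefficients. What is left, up to a global minus, is the sign `chiSign` of the corresponding
(2,1)-unshuffle. -/
theorem ceDifferential_two (br : E → E → E) (q : ZMod 2) (θ : (Fin 2 → E) → F)
    (p : Fin 3 → ZMod 2) (X : Fin 3 → E) :
    ceDifferential br (fun _ _ => (0 : F)) q θ p X =
      -(θ ![br (X 0) (X 1), X 2] - paritySign (p 1 * p 2) • θ ![br (X 0) (X 2), X 1]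
        + (paritySign (p 0 * p 1) * paritySign (p 0 * p 2)) • θ ![br (X 1) (X 2), X 0]) := by
  have e01 : (fun k => X (skipTwo 0 1 k)) = ![X 2] := by funext k; fin_cases k; rfl
  have e02 : (fun k => X (skipTwo 0 2 k)) = ![X 1] := by funext k; fin_cases k; rfl
  have e12 : (fun k => X (skipTwo 1 2 k)) = ![X 0] := by funext k; fin_cases k; rfl
  have I0 : Finset.Ioi (0 : Fin 3) = {1, 2} := by decide
  have I1 : Finset.Ioi (1 : Fin 3) = {2} := by decide
  have I2 : Finset.Ioi (2 : Fin 3) = ∅ := by decide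
  have J0 : Finset.Iio (0 : Fin 3) = ∅ := by decide
  have J1 : Finset.Iio (1 : Fin 3) = {0} := by decide
  have J2 : Finset.Iio (2 : Fin 3) = {0, 1} := by decide
  have s01 := paritySign_mul_self (p 0 * p 1)
  have s02 := paritySign_mul_self (p 0 * p 2)
  have s12 := paritySign_mul_self (p 1 * p 2)
  simp only [ceDifferential, smul_zero, Finset.sum_const_zero, zero_add]
  change ∑ i : Fin 3, ∑ j ∈ Finset.Ioi i,
      ((-1) ^ ((i : ℕ) + (j : ℕ)) * paritySign (p i * p j) * frontSign p i * frontSign p j) •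
        θ (Fin.cons (br (X i) (X j)) (fun k => X (skipTwo i j k))) = _
  simp only [Fin.sum_univ_three, I0, I1, I2,
    Finset.sum_pair (show (1 : Fin 3) ≠ 2 by decide), Finset.sum_singleton,
    Finset.sum_empty, add_zero, e01, e02, e12, frontSign, J0, J1, J2,
    Finset.sum_pair (show (0 : Fin 3) ≠ 1 by decide), mul_zero, paritySign_zero, mul_one,
    mul_add, paritySign_add, mul_comm (p 1) (p 0), mul_comm (p 2) (p 0), mul_comm (p 2) (p 1)]
  have c01 : ((-1 : ℝ) ^ (((0 : Fin 3) : ℕ) + ((1 : Fin 3) : ℕ)) * paritySign (p 0 * p 1)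
      * paritySign (p 0 * p 1)) = -1 := by
    simp [s01]
  have c02 : ((-1 : ℝ) ^ (((0 : Fin 3) : ℕ) + ((2 : Fin 3) : ℕ)) * paritySign (p 0 * p 2)
      * (paritySign (p 0 * p 2) * paritySign (p 1 * p 2))) = paritySign (p 1 * p 2) := by
    simp [← mul_assoc, s02]
  have c12 : ((-1 : ℝ) ^ (((1 : Fin 3) : ℕ) + ((2 : Fin 3) : ℕ)) * paritySign (p 1 * p 2)
      * paritySign (p 0 * p 1) * (paritySign (p 0 * p 2) * paritySign (p 1 * p 2)))
      = -(paritySign (p 0 * p 1) * paritySign (p 0 * p 2)) := by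
    norm_num
    linear_combination (paritySign (p 0 * p 1) * paritySign (p 0 * p 2)) * s12
  rw [c01, c02, c12]
  simp only [Matrix.vecCons]
  module

/-- The coefficients are, up to a global minus, the signs `chiSign` of the six (2,2)-unshuffles.
Hence vanishing of the differential is the generalized Jacobi identity in four arguments. -/
theorem ceDifferential_three (br : E → E → E) (q : ZMod 2) (ω : (Fin 3 → E) → F)
    (p : Fin 4 → ZMod 2) (X : Fin 4 → E) :
    ceDifferential br (fun _ _ => (0 : F)) q ω p X =
      -(ω ![br (X 0) (X 1), X 2, X 3] - paritySign (p 1 * p 2) • ω ![br (X 0) (X 2), X 1, X 3]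
        + (paritySign (p 1 * p 3) * paritySign (p 2 * p 3)) • ω ![br (X 0) (X 3), X 1, X 2]
        + (paritySign (p 0 * p 1) * paritySign (p 0 * p 2)) • ω ![br (X 1) (X 2), X 0, X 3]
        - (paritySign (p 0 * p 1) * paritySign (p 0 * p 3) * paritySign (p 2 * p 3)) •
            ω ![br (X 1) (X 3), X 0, X 2]
        + (paritySign (p 0 * p 2) * paritySign (p 0 * p 3) * paritySign (p 1 * p 2)
            * paritySign (p 1 * p 3)) • ω ![br (X 2) (X 3), X 0, X 1]) := by
  have e01 : (fun k => X (skipTwo 0 1 k)) = ![X 2, X 3] := by funext k; fin_cases k <;> rfl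
  have e02 : (fun k => X (skipTwo 0 2 k)) = ![X 1, X 3] := by funext k; fin_cases k <;> rfl
  have e03 : (fun k => X (skipTwo 0 3 k)) = ![X 1, X 2] := by funext k; fin_cases k <;> rfl
  have e12 : (fun k => X (skipTwo 1 2 k)) = ![X 0, X 3] := by funext k; fin_cases k <;> rfl
  have e13 : (fun k => X (skipTwo 1 3 k)) = ![X 0, X 2] := by funext k; fin_cases k <;> rfl
  have e23 : (fun k => X (skipTwo 2 3 k)) = ![X 0, X 1] := by funext k; fin_cases k <;> rfl
  have I0 : ∀ f : Fin 4 → F, ∑ j ∈ Finset.Ioi 0, f j = f 1 + f 2 + f 3 := fun f => by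
    rw [show Finset.Ioi (0 : Fin 4) = {1, 2, 3} by decide, Finset.sum_insert (by decide),
      Finset.sum_pair (by decide), add_assoc]
  have I1 : ∀ f : Fin 4 → F, ∑ j ∈ Finset.Ioi 1, f j = f 2 + f 3 := fun f => by
    rw [show Finset.Ioi (1 : Fin 4) = {2, 3} by decide, Finset.sum_pair (by decide)]
  have I2 : ∀ f : Fin 4 → F, ∑ j ∈ Finset.Ioi 2, f j = f 3 := fun f => by
    rw [show Finset.Ioi (2 : Fin 4) = {3} by decide, Finset.sum_singleton]
  have I3 : ∀ f : Fin 4 → F, ∑ j ∈ Finset.Ioi 3, f j = 0 := fun f => by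
    rw [show Finset.Ioi (3 : Fin 4) = ∅ by decide, Finset.sum_empty]
  have J0 : ∑ k ∈ Finset.Iio 0, p k = 0 := by
    rw [show Finset.Iio (0 : Fin 4) = ∅ by decide, Finset.sum_empty]
  have J1 : ∑ k ∈ Finset.Iio 1, p k = p 0 := by
    rw [show Finset.Iio (1 : Fin 4) = {0} by decide, Finset.sum_singleton]
  have J2 : ∑ k ∈ Finset.Iio 2, p k = p 0 + p 1 := by
    rw [show Finset.Iio (2 : Fin 4) = {0, 1} by decide, Finset.sum_pair (by decide)]
  have J3 : ∑ k ∈ Finset.Iio 3, p k = p 0 + p 1 + p 2 := by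
    rw [show Finset.Iio (3 : Fin 4) = {0, 1, 2} by decide, Finset.sum_insert (by decide),
      Finset.sum_pair (by decide), add_assoc]
  have s01 := paritySign_mul_self (p 0 * p 1)
  have s02 := paritySign_mul_self (p 0 * p 2)
  have s03 := paritySign_mul_self (p 0 * p 3)
  have s12 := paritySign_mul_self (p 1 * p 2)
  have s13 := paritySign_mul_self (p 1 * p 3)
  have s23 := paritySign_mul_self (p 2 * p 3)
  simp only [ceDifferential, smul_zero, Finset.sum_const_zero, zero_add]
  change ∑ i : Fin 4, ∑ j ∈ Finset.Ioi i,
      ((-1) ^ ((i : ℕ) + (j : ℕ)) * paritySign (p i * p j) * frontSign p i * frontSign p j) •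
        ω (Fin.cons (br (X i) (X j)) (fun k => X (skipTwo i j k))) = _
  simp only [Fin.sum_univ_four, I0, I1, I2, I3, add_zero, e01, e02, e03, e12, e13, e23,
    frontSign, J0, J1, J2, J3,
    mul_zero, paritySign_zero, mul_one, mul_add, paritySign_add, mul_comm (p 1) (p 0),
    mul_comm (p 2) (p 0), mul_comm (p 3) (p 0), mul_comm (p 2) (p 1), mul_comm (p 3) (p 1),
    mul_comm (p 3) (p 2)]
  generalize paritySign (p 0 * p 1) = a at *
  generalize paritySign (p 0 * p 2) = b at *
  generalize paritySign (p 0 * p 3) = c at *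
  generalize paritySign (p 1 * p 2) = d at *
  generalize paritySign (p 1 * p 3) = e at *
  generalize paritySign (p 2 * p 3) = f at *
  have n : (((0 : Fin 4) : ℕ) = 0) ∧ (((1 : Fin 4) : ℕ) = 1) ∧ (((2 : Fin 4) : ℕ) = 2)
    ∧ (((3 : Fin 4) : ℕ) = 3) := ⟨rfl, rfl, rfl, rfl⟩
  simp only [n]
  have c01 : (-1 : ℝ) ^ (0 + 1) * a * a = -1 := by linear_combination -s01
  have c02 : (-1 : ℝ) ^ (0 + 2) * b * (b * d) = d := by linear_combination d * s02
  have c03 : (-1 : ℝ) ^ (0 + 3) * c * (c * e * f) = -(e * f) := by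
    linear_combination -(e * f) * s03
  have c12 : (-1 : ℝ) ^ (1 + 2) * d * a * (b * d) = -(a * b) := by
    linear_combination -(a * b) * s12
  have c13 : (-1 : ℝ) ^ (1 + 3) * e * a * (c * e * f) = a * c * f := by
    linear_combination (a * c * f) * s13
  have c23 : (-1 : ℝ) ^ (2 + 3) * f * (b * d) * (c * e * f) = -(b * c * d * e) := by
    linear_combination -(b * c * d * e) * s23
  rw [c01, c02, c03, c12, c13, c23]
  simp only [Matrix.vecCons]
  module

end LowDegree

/-! ### Lie superalgebras and 3-cocycles as `L_∞`-superalgebras -/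

section Extension

variable {E : Type*} [AddCommGroup E] [Module ℝ E]
  {𝒜 : ZMod 2 → Submodule ℝ E} {br : E →ₗ[ℝ] E →ₗ[ℝ] E}

theorem evenLine_zero : evenLine 0 = ⊤ := if_pos rfl

theorem evenLine_one : evenLine 1 = ⊥ := if_neg (by decide)

theorem IsLieSuperalgebra.bracket_swap (h : IsLieSuperalgebra 𝒜 br)
    (σ : Equiv.Perm (Fin 2)) (p : Fin 2 → ZMod 2) (x : Fin 2 → E) (hx : ∀ i, x i ∈ 𝒜 (p i)) :
    br (x (σ 0)) (x (σ 1)) = chiSign σ p • br (x 0) (x 1) := by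
  rcases perm_fin_two_eq σ with rfl | rfl
  · simp [chiSign_one]
  · rw [chiSign_swap_fin_two, Equiv.swap_apply_left, Equiv.swap_apply_right,
      h.skew (hx 1) (hx 0), neg_smul, mul_comm]

/-- The derivation form of the Jacobi identity is brought, by skewness, to the left-nested form in
which `jacobiator` is written. -/
theorem IsLieSuperalgebra.jacobi_cyclic (h : IsLieSuperalgebra 𝒜 br) {p q r : ZMod 2} {x y z : E}
    (hx : x ∈ 𝒜 p) (hy : y ∈ 𝒜 q) (hz : z ∈ 𝒜 r) :
    br (br x y) z - paritySign (q * r) • br (br x z) y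
      + (paritySign (p * q) * paritySign (p * r)) • br (br y z) x = 0 := by
  rw [h.skew (h.bracket_mem hx hz) hy, h.skew (h.bracket_mem hy hz) hx, h.jacobi hx hy z]
  simp only [add_mul, paritySign_add, mul_comm q p, mul_comm r p, mul_comm r q]
  have s₁ := paritySign_mul_self (p * q)
  have s₂ := paritySign_mul_self (p * r)
  have s₃ := paritySign_mul_self (q * r)
  generalize paritySign (p * q) = a at *
  generalize paritySign (p * r) = b at *
  generalize paritySign (q * r) = c at *
  have e₁ : a * b * (a * b) = 1 := by linear_combination b * b * s₁ + s₂
  have e₂ : c * (a * c) = a := by linear_combination a * s₃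
  simp only [smul_neg, smul_smul, e₁, e₂]
  module

open Classical in
theorem IsLieSuperalgebra.sum_unshuffles (h : IsLieSuperalgebra 𝒜 br) (p : Fin 3 → ZMod 2)
    (x : Fin 3 → E) (hx : ∀ i, x i ∈ 𝒜 (p i)) :
    ∑ σ : Equiv.Perm (Fin 3) with IsUnshuffle 2 σ,
      chiSign σ p • br (br (x (σ 0)) (x (σ 1))) (x (σ 2)) = 0 := by
  have := h.jacobi_cyclic (hx 0) (hx 1) (hx 2)
  rw [sum_unshuffles_two_one, chiSign_one, chiSign_swap_one_two, chiSign_cycle_fin_three]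
  simpa [Equiv.swap_apply_def, sub_eq_add_neg] using this

open Classical in
theorem IsEvenCocycle.sum_unshuffles {ω : MultilinearMap ℝ (fun _ : Fin 3 => E) ℝ}
    (h : IsEvenCocycle 𝒜 br ω) (p : Fin 4 → ZMod 2) (x : Fin 4 → E) (hx : ∀ i, x i ∈ 𝒜 (p i)) :
    ∑ σ : Equiv.Perm (Fin 4) with IsUnshuffle 2 σ,
      chiSign σ p • ω ![br (x (σ 0)) (x (σ 1)), x (σ 2), x (σ 3)] = 0 := by
  have := h.2 p x hx
  rw [ceDifferential_three, neg_eq_zero] at this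
  rw [sum_unshuffles_two_two, chiSign_one, chiSign_swap_one_two_fin_four,
    chiSign_unshuffle_zero_three, chiSign_unshuffle_one_two, chiSign_unshuffle_one_three,
    chiSign_unshuffle_two_three]
  simp only [Equiv.swap_apply_def, Equiv.Perm.mul_apply, Equiv.Perm.one_apply]
  simpa [sub_eq_add_neg] using this

variable (𝒜 br)

theorem lieLInfinity_l_of_ne {k : ℕ} (hk : k ≠ 2) : (lieLInfinity 𝒜 br).l k = 0 := by
  match k, hk with
  | 0, _ => rfl
  | 1, _ => rfl
  | _ + 3, _ => rfl

/-- In degree 0 the overall grade is the parity, and all other pieces are zero. The signs of the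
`L_∞` axioms are therefore those of the Lie superalgebra. -/
theorem mem_of_mem_lieLInfinity_grading {g : ℤ × ZMod 2} {x : E}
    (hx : x ∈ (lieLInfinity 𝒜 br).grading g) : x ∈ 𝒜 (overallGrade g) := by
  rcases g with ⟨d, p⟩
  by_cases hd : d = 0
  · subst hd
    simpa [lieLInfinity, overallGrade] using hx
  · have : x = 0 := by simpa [lieLInfinity, hd] using hx
    rw [this]
    exact zero_mem _

variable {𝒜 br}

theorem isInternal_lieLInfinity_grading (h : DirectSum.IsInternal 𝒜) :
    DirectSum.IsInternal (lieLInfinity 𝒜 br).grading := by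
  rw [DirectSum.isInternal_submodule_iff_iSupIndep_and_iSup_eq_top] at h ⊢
  constructor
  · rintro ⟨d, p⟩
    by_cases hd : d = 0
    · subst hd
      refine (h.1 p).mono (by simp [lieLInfinity]) (iSup₂_le ?_)
      rintro ⟨d', q⟩ hne
      by_cases hd' : d' = 0
      · subst hd'
        have hq : q ≠ p := fun e => hne (by rw [e])
        simpa [lieLInfinity] using le_iSup₂_of_le (f := fun j (_ : j ≠ p) => 𝒜 j) q hq le_rfl
      · simp [lieLInfinity, hd']
    · simp [lieLInfinity, hd]
  · rw [← top_le_iff, ← h.2]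
    refine iSup_le fun p => le_iSup_of_le (0, p) ?_
    simp [lieLInfinity]

theorem IsLieSuperalgebra.isLieNSuperalgebra_lieLInfinity (h : IsLieSuperalgebra 𝒜 br) :
    LInfinityData.IsLieNSuperalgebra 2 (lieLInfinity 𝒜 br) := by
  refine ⟨⟨isInternal_lieLInfinity_grading h.isInternal, ?_, rfl, ?_, ?_, ?_⟩, ?_⟩
  · intro d p hd
    simp [lieLInfinity, hd.ne]
  · intro k g x hx
    by_cases hk : k = 2
    · subst hk
      by_cases hg : ∀ i, (g i).1 = 0
      · have hx' : ∀ i, x i ∈ 𝒜 (g i).2 := fun i => by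
          simpa [lieLInfinity, hg i] using hx i
        have := h.bracket_mem (hx' 0) (hx' 1)
        simpa [lieLInfinity, bilinToMultilinear, hg, Fin.sum_univ_two] using this
      · push Not at hg
        obtain ⟨i, hi⟩ := hg
        have : x i = 0 := by simpa [lieLInfinity, hi] using hx i
        rw [MultilinearMap.map_coord_zero _ i this]
        exact zero_mem _
    · rw [lieLInfinity_l_of_ne _ _ hk]
      exact zero_mem _
  · intro k σ g x hx
    by_cases hk : k = 2
    · subst hk
      exact h.bracket_swap σ _ x fun i => mem_of_mem_lieLInfinity_grading 𝒜 br (hx i)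
    · simp [lieLInfinity_l_of_ne _ _ hk]
  · intro n g x hx
    rw [LInfinityData.jacobiator]
    by_cases hn : n = 3
    · subst hn
      -- The index `a = 1` stands for `i = 2`, so this is the term `l₂ ∘ l₂`; every other inner
      -- bracket is zero.
      rw [Finset.sum_eq_single (1 : Fin 3)]
      · have := h.sum_unshuffles _ x fun i => mem_of_mem_lieLInfinity_grading 𝒜 br (hx i)
        rw [← this]
        refine Finset.sum_congr rfl fun σ _ => ?_
        change (_ * (-1 : ℝ) ^ 2) • br (br (x (σ 0)) (x (σ 1))) (x (σ 2)) = _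
        simp
      · intro a _ ha
        refine Finset.sum_eq_zero fun σ _ => ?_
        rw [MultilinearMap.map_coord_zero _ 0, smul_zero]
        rw [Fin.cons_zero, lieLInfinity_l_of_ne _ _ (by omega)]
        rfl
      · simp
    · refine Finset.sum_eq_zero fun a _ => Finset.sum_eq_zero fun σ _ => ?_
      by_cases ha : (a : ℕ) + 1 = 2
      · rw [lieLInfinity_l_of_ne (k := n - ((a : ℕ) + 1) + 1) _ _ (by omega)]
        simp
      · rw [MultilinearMap.map_coord_zero _ 0, smul_zero]
        rw [Fin.cons_zero, lieLInfinity_l_of_ne _ _ ha]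
        rfl
  · intro d p hd
    have : d ≠ 0 := by push_cast at hd; omega
    simp [lieLInfinity, this]

theorem isLieNSuperalgebra_bLine : LInfinityData.IsLieNSuperalgebra 2 bLine := by
  refine ⟨⟨?_, ?_, rfl, ?_, ?_, ?_⟩, ?_⟩
  · rw [DirectSum.isInternal_submodule_iff_iSupIndep_and_iSup_eq_top]
    constructor
    · rintro ⟨d, p⟩
      by_cases hg : (d, p) = (1, 0)
      · refine disjoint_bot_right.mono_right (iSup₂_le ?_)
        rintro ⟨d', q⟩ hne
        rw [hg] at hne
        by_cases hd : d' = 1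
        · subst hd
          rcases parity_cases q with rfl | rfl
          · exact absurd rfl hne
          · simp [bLine, evenLine_one]
        · simp [bLine, hd]
      · by_cases hd : d = 1
        · subst hd
          rcases parity_cases p with rfl | rfl
          · exact absurd rfl hg
          · simp [bLine, evenLine_one]
        · simp [bLine, hd]
    · rw [← top_le_iff]
      refine le_iSup_of_le (1, 0) ?_
      simp [bLine, evenLine_zero]
  · intro d p hd
    have : d ≠ 1 := by omega
    simp [bLine, this]
  · intro k g x _
    exact zero_mem _
  · intro k σ g x _
    simp [bLine]
  · intro n g x _
    simp [LInfinityData.jacobiator, bLine]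
  · intro d p hd
    have : d ≠ 1 := by push_cast at hd; omega
    simp [bLine, this]

/-! ### Extension of a Lie superalgebra by a real-valued 3-cocycle -/

variable (𝒜 br) (ω : MultilinearMap ℝ (fun _ : Fin 3 => E) ℝ)

theorem cocycleExtension_l_of_ne {k : ℕ} (hk : k ≠ 2) (hk' : k ≠ 3) :
    (cocycleExtension 𝒜 br ω).l k = 0 := by
  match k, hk, hk' with
  | 0, _, _ => rfl
  | 1, _, _ => rfl
  | _ + 4, _, _ => rfl

theorem cocycleExtension_l_two (v : Fin 2 → E × ℝ) :
    (cocycleExtension 𝒜 br ω).l 2 v = (br (v 0).1 (v 1).1, 0) := rfl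

theorem cocycleExtension_l_three (v : Fin 3 → E × ℝ) :
    (cocycleExtension 𝒜 br ω).l 3 v = (0, ω fun i => (v i).1) := rfl

theorem cocycleExtension_l_fst_of_ne {k : ℕ} (hk : k ≠ 2) (v : Fin k → E × ℝ) :
    ((cocycleExtension 𝒜 br ω).l k v).1 = 0 := by
  by_cases hk' : k = 3
  · subst hk'; rfl
  · rw [cocycleExtension_l_of_ne _ _ _ hk hk']; rfl

/-- Every bracket factors through the projection of its arguments to `E`, so an argument in the real
line kills it. -/
theorem cocycleExtension_l_eq_zero {k : ℕ} (v : Fin k → E × ℝ) (i : Fin k) (hi : (v i).1 = 0) :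
    (cocycleExtension 𝒜 br ω).l k v = 0 := by
  by_cases hk : k = 2
  · subst hk
    rw [cocycleExtension_l_two]
    fin_cases i
    · simp [show (v 0).1 = 0 from hi]
    · simp [show (v 1).1 = 0 from hi]
  · by_cases hk' : k = 3
    · subst hk'
      rw [cocycleExtension_l_three, ω.map_coord_zero i hi]
      rfl
    · rw [cocycleExtension_l_of_ne _ _ _ hk hk']; rfl

theorem cocycleExtension_grading_zero (p : ZMod 2) :
    (cocycleExtension 𝒜 br ω).grading (0, p) = (𝒜 p).prod ⊥ := by
  simp [cocycleExtension]

theorem cocycleExtension_grading_one (p : ZMod 2) :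
    (cocycleExtension 𝒜 br ω).grading (1, p) = (⊥ : Submodule ℝ E).prod (evenLine p) := by
  simp [cocycleExtension]

theorem cocycleExtension_grading_of_ne {d : ℤ} (hd : d ≠ 0) (hd' : d ≠ 1) (p : ZMod 2) :
    (cocycleExtension 𝒜 br ω).grading (d, p) = ⊥ := by
  simp [cocycleExtension, hd, hd']

theorem fst_eq_zero_of_mem_cocycleExtension_grading {g : ℤ × ZMod 2} (hg : g.1 ≠ 0) {x : E × ℝ}
    (hx : x ∈ (cocycleExtension 𝒜 br ω).grading g) : x.1 = 0 := by
  rcases g with ⟨d, p⟩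
  by_cases hd : d = 1
  · subst hd
    rw [cocycleExtension_grading_one] at hx
    exact hx.1
  · rw [cocycleExtension_grading_of_ne _ _ _ hg hd] at hx
    rw [(Submodule.mem_bot ℝ).1 hx]
    rfl

theorem fst_mem_of_mem_cocycleExtension_grading {g : ℤ × ZMod 2} {x : E × ℝ}
    (hx : x ∈ (cocycleExtension 𝒜 br ω).grading g) : x.1 ∈ 𝒜 (overallGrade g) := by
  rcases g with ⟨d, p⟩
  by_cases hd : d = 0
  · subst hd
    rw [cocycleExtension_grading_zero] at hx
    simpa [overallGrade] using hx.1
  · rw [fst_eq_zero_of_mem_cocycleExtension_grading 𝒜 br ω hd hx]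
    exact zero_mem _

variable {𝒜}

theorem isInternal_cocycleExtension_grading (h : DirectSum.IsInternal 𝒜) :
    DirectSum.IsInternal (cocycleExtension 𝒜 br ω).grading := by
  rw [DirectSum.isInternal_submodule_iff_iSupIndep_and_iSup_eq_top] at h ⊢
  constructor
  · rintro ⟨d, p⟩
    by_cases hd : d = 0
    · subst hd
      rw [cocycleExtension_grading_zero]
      -- The remaining pieces have first component in the span of the other parity pieces. An
      -- element also lying in `(𝒜 p).prod ⊥` then vanishes in both coordinates.
      have hle : ⨆ j, ⨆ (_ : j ≠ ((0 : ℤ), p)), (cocycleExtension 𝒜 br ω).grading j ≤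
          (⨆ q, ⨆ (_ : q ≠ p), 𝒜 q).prod ⊤ := by
        refine iSup₂_le ?_
        rintro ⟨d', q⟩ hne x hx
        refine ⟨?_, trivial⟩
        by_cases hd' : d' = 0
        · subst hd'
          have hq : q ≠ p := fun e => hne (by rw [e])
          rw [cocycleExtension_grading_zero] at hx
          exact le_iSup₂_of_le (f := fun j (_ : j ≠ p) => 𝒜 j) q hq le_rfl hx.1
        · rw [fst_eq_zero_of_mem_cocycleExtension_grading 𝒜 br ω hd' hx]
          exact zero_mem _
      refine Disjoint.mono_right hle ?_
      rw [Submodule.disjoint_def]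
      rintro ⟨e, r⟩ ⟨he, hr⟩ ⟨he', -⟩
      exact Prod.ext (Submodule.disjoint_def.1 (h.1 p) e he he') hr
    · by_cases hd1 : d = 1
      · subst hd1
        rw [cocycleExtension_grading_one]
        rcases parity_cases p with rfl | rfl
        · have hle : ⨆ j, ⨆ (_ : j ≠ ((1 : ℤ), (0 : ZMod 2))),
              (cocycleExtension 𝒜 br ω).grading j ≤ (⊤ : Submodule ℝ E).prod ⊥ := by
            refine iSup₂_le ?_
            rintro ⟨d', q⟩ hne x hx
            refine ⟨trivial, ?_⟩
            by_cases hd' : d' = 0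
            · subst hd'
              rw [cocycleExtension_grading_zero] at hx
              exact hx.2
            · by_cases hd'' : d' = 1
              · subst hd''
                rcases parity_cases q with rfl | rfl
                · exact absurd rfl hne
                · rw [cocycleExtension_grading_one, evenLine_one] at hx
                  exact hx.2
              · rw [cocycleExtension_grading_of_ne _ _ _ hd' hd''] at hx
                rw [(Submodule.mem_bot ℝ).1 hx]
                exact zero_mem _
          refine Disjoint.mono_right hle ?_
          rw [Submodule.disjoint_def]
          rintro ⟨e, r⟩ ⟨he, -⟩ ⟨-, hr⟩
          exact Prod.ext he hr
        · simp [evenLine_one]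
      · rw [cocycleExtension_grading_of_ne _ _ _ hd hd1]
        exact disjoint_bot_left
  · rw [eq_top_iff]
    rintro ⟨e, r⟩ -
    have he : e ∈ (⨆ g, (cocycleExtension 𝒜 br ω).grading g).comap (LinearMap.inl ℝ E ℝ) := by
      have hle : ⨆ p, 𝒜 p ≤
          (⨆ g, (cocycleExtension 𝒜 br ω).grading g).comap (LinearMap.inl ℝ E ℝ) := by
        refine iSup_le fun p x hx => ?_
        refine Submodule.mem_iSup_of_mem ((0 : ℤ), p) ?_
        rw [cocycleExtension_grading_zero]
        exact ⟨hx, rfl⟩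
      exact hle (h.2 ▸ trivial)
    have hr : ((0 : E), r) ∈ ⨆ g, (cocycleExtension 𝒜 br ω).grading g := by
      refine Submodule.mem_iSup_of_mem ((1 : ℤ), (0 : ZMod 2)) ?_
      rw [cocycleExtension_grading_one, evenLine_zero]
      exact ⟨rfl, trivial⟩
    simpa using add_mem (show (e, (0 : ℝ)) ∈ _ from he) hr

variable {br} {ω}

theorem IsEvenCocycle.isLieNSuperalgebra_cocycleExtension (h : IsLieSuperalgebra 𝒜 br)
    (hω : IsEvenCocycle 𝒜 br ω) :
    LInfinityData.IsLieNSuperalgebra 2 (cocycleExtension 𝒜 br ω) := by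
  refine ⟨⟨isInternal_cocycleExtension_grading br ω h.isInternal, ?_, rfl, ?_, ?_, ?_⟩, ?_⟩
  · intro d p hd
    exact cocycleExtension_grading_of_ne _ _ _ hd.ne (by omega) p
  · intro k g x hx
    by_cases hg : ∀ i, (g i).1 = 0
    · have hx' : ∀ i, (x i).1 ∈ 𝒜 (g i).2 := fun i => by
        have := hx i
        rw [show g i = (0, (g i).2) from Prod.ext (hg i) rfl, cocycleExtension_grading_zero]
          at this
        exact this.1
      have hs : ∑ i, (g i).1 = 0 := Finset.sum_eq_zero fun i _ => hg i
      rw [hs, zero_add]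
      by_cases hk : k = 2
      · subst hk
        have := h.bracket_mem (hx' 0) (hx' 1)
        rw [show ((2 : ℕ) : ℤ) - 2 = 0 from rfl, cocycleExtension_grading_zero,
          Fin.sum_univ_two]
        exact ⟨this, rfl⟩
      · by_cases hk' : k = 3
        · subst hk'
          have := hω.1.parity _ _ hx'
          rw [add_zero] at this
          rw [show ((3 : ℕ) : ℤ) - 2 = 1 from rfl, cocycleExtension_grading_one]
          exact ⟨rfl, this⟩
        · rw [cocycleExtension_l_of_ne _ _ _ hk hk']
          exact zero_mem _
    · push Not at hg
      obtain ⟨i, hi⟩ := hg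
      rw [cocycleExtension_l_eq_zero _ _ _ x i
        (fst_eq_zero_of_mem_cocycleExtension_grading _ _ _ hi (hx i))]
      exact zero_mem _
  · intro k σ g x hx
    have hx' := fun i => fst_mem_of_mem_cocycleExtension_grading _ _ _ (hx i)
    by_cases hk : k = 2
    · subst hk
      rw [cocycleExtension_l_two, cocycleExtension_l_two,
        h.bracket_swap σ _ (fun i => (x i).1) hx', Prod.smul_mk, smul_zero]
    · by_cases hk' : k = 3
      · subst hk'
        rw [cocycleExtension_l_three, cocycleExtension_l_three,
          hω.1.skew σ _ (fun i => (x i).1) hx', Prod.smul_mk, smul_zero]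
      · simp [cocycleExtension_l_of_ne _ _ _ hk hk']
  · intro n g x hx
    have hx' := fun i => fst_mem_of_mem_cocycleExtension_grading _ _ _ (hx i)
    -- Only `l₂` produces a component in `E`, so a composite with any other inner bracket vanishes.
    -- There remain `l₂ ∘ l₂` for three arguments and `l₃ ∘ l₂` for four.
    have hz : ∀ {m k : ℕ}, k ≠ 2 → ∀ (v : Fin k → E × ℝ) (w : Fin m → E × ℝ),
        (cocycleExtension 𝒜 br ω).l (m + 1)
          (Fin.cons ((cocycleExtension 𝒜 br ω).l k v) w) = 0 := fun hk v w =>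
      cocycleExtension_l_eq_zero _ _ _ _ 0 (cocycleExtension_l_fst_of_ne _ _ _ hk v)
    rw [LInfinityData.jacobiator]
    by_cases hn : n = 3
    · subst hn
      rw [Finset.sum_eq_single (1 : Fin 3)]
      · have := h.sum_unshuffles _ (fun i => (x i).1) hx'
        apply_fun LinearMap.inl ℝ E ℝ at this
        rw [map_zero, map_sum] at this
        rw [← this]
        refine Finset.sum_congr rfl fun σ _ => ?_
        change (_ * (-1 : ℝ) ^ 2) •
          ((br (br (x (σ 0)).1 (x (σ 1)).1) (x (σ 2)).1, 0) : E × ℝ) = _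
        simp
      · intro a _ ha
        refine Finset.sum_eq_zero fun σ _ => ?_
        rw [hz (by omega), smul_zero]
      · simp
    · by_cases hn' : n = 4
      · subst hn'
        rw [Finset.sum_eq_single (1 : Fin 4)]
        · have := hω.sum_unshuffles _ (fun i => (x i).1) hx'
          apply_fun LinearMap.inr ℝ E ℝ at this
          rw [map_zero, map_sum] at this
          rw [← this]
          refine Finset.sum_congr rfl fun σ _ => ?_
          have e : ∀ y : E × ℝ, (fun i => ((Fin.cons y
              (fun c : Fin 2 => x (σ ⟨((1 : Fin 4) : ℕ) + 1 + c, by omega⟩)) :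
                Fin 3 → E × ℝ) i).1) = ![y.1, (x (σ 2)).1, (x (σ 3)).1] := fun y => by
            funext i; fin_cases i <;> rfl
          change (_ * (-1 : ℝ) ^ 4) • ((0, ω fun i => ((Fin.cons
            ((br (x (σ 0)).1 (x (σ 1)).1, 0) : E × ℝ)
              (fun c : Fin 2 => x (σ ⟨((1 : Fin 4) : ℕ) + 1 + c, by omega⟩)) :
                Fin 3 → E × ℝ) i).1) : E × ℝ) = _
          rw [e, show (-1 : ℝ) ^ 4 = 1 by norm_num, mul_one]
          simp
        · intro a _ ha
          refine Finset.sum_eq_zero fun σ _ => ?_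
          rw [hz (by omega), smul_zero]
        · simp
      · refine Finset.sum_eq_zero fun a _ => Finset.sum_eq_zero fun σ _ => ?_
        by_cases ha : (a : ℕ) + 1 = 2
        · rw [cocycleExtension_l_of_ne (k := n - ((a : ℕ) + 1) + 1) _ _ _ (by omega) (by omega)]
          simp
        · rw [hz ha, smul_zero]
  · intro d p hd
    push_cast at hd
    exact cocycleExtension_grading_of_ne _ _ _ (by omega) (by omega) p

/-! ### The short exact sequence of the extension -/

variable (𝒜 br ω)

theorem isShortExact_cocycleExtension :
    LInfinityData.IsShortExact bLine (cocycleExtension 𝒜 br ω) (lieLInfinity 𝒜 br)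
      (LinearMap.inr ℝ E ℝ) (LinearMap.fst ℝ E ℝ) where
  isHom_left := by
    constructor
    · rintro ⟨d, p⟩ x hx
      by_cases hd : d = 1
      · subst hd
        rw [cocycleExtension_grading_one]
        exact ⟨rfl, by simpa [bLine] using hx⟩
      · have : x = 0 := by simpa [bLine, hd] using hx
        rw [this, map_zero]
        exact zero_mem _
    · intro k x
      change LinearMap.inr ℝ E ℝ 0 = _
      rw [map_zero]
      match k with
      | 0 => rfl
      | k + 1 => exact (cocycleExtension_l_eq_zero _ _ _ _ 0 rfl).symm
  isHom_right := by
    constructor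
    · rintro ⟨d, p⟩ x hx
      by_cases hd : d = 0
      · subst hd
        rw [cocycleExtension_grading_zero] at hx
        simpa [lieLInfinity] using hx.1
      · rw [LinearMap.fst_apply, fst_eq_zero_of_mem_cocycleExtension_grading 𝒜 br ω hd hx]
        exact zero_mem _
    · intro k x
      by_cases hk : k = 2
      · subst hk; rfl
      · rw [LinearMap.fst_apply, cocycleExtension_l_fst_of_ne _ _ _ hk,
          lieLInfinity_l_of_ne _ _ hk]
        rfl
  injective := LinearMap.inr_injective
  exact := LinearMap.exact_iff.2 (LinearMap.ker_fst ..)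
  surjective := LinearMap.fst_surjective

/-! ### Exactness of the extension and coboundaries -/

variable {𝒜 br ω}

/-- The real component of a cochain on `E ⊕ ℝ` restricted to `E`. -/
theorem IsCochain.snd_comp_inl {m : ℕ} {q : ZMod 2}
    {θ : MultilinearMap ℝ (fun _ : Fin m => E × ℝ) (E × ℝ)}
    (h : IsCochain (fun p => (cocycleExtension 𝒜 br ω).grading (0, p))
      (fun p => (cocycleExtension 𝒜 br ω).grading (((1 : ℕ) : ℤ), p)) q θ) :
    IsCochain 𝒜 evenLine q ((LinearMap.snd ℝ E ℝ).compMultilinearMap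
      (θ.compLinearMap fun _ => LinearMap.inl ℝ E ℝ)) := by
  have hmem : ∀ (p : Fin m → ZMod 2) (X : Fin m → E), (∀ i, X i ∈ 𝒜 (p i)) → ∀ i,
      LinearMap.inl ℝ E ℝ (X i) ∈ (cocycleExtension 𝒜 br ω).grading (0, p i) :=
    fun p X hX i => by
      rw [cocycleExtension_grading_zero]
      exact ⟨hX i, rfl⟩
  constructor
  · intro σ p X hX
    exact congrArg Prod.snd (h.skew σ p (fun i => LinearMap.inl ℝ E ℝ (X i)) (hmem p X hX))
  · intro p X hX
    have := h.parity p (fun i => LinearMap.inl ℝ E ℝ (X i)) (hmem p X hX)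
    rw [Nat.cast_one, cocycleExtension_grading_one] at this
    exact this.2

/-- The bracket `l₂` has zero real component, so after projection the action terms vanish and the
coefficients become the trivial representation. -/
theorem snd_ceDifferential_cocycleExtension {m : ℕ} (q : ZMod 2)
    (θ : MultilinearMap ℝ (fun _ : Fin (m + 1) => E × ℝ) (E × ℝ))
    (p : Fin (m + 2) → ZMod 2) (X : Fin (m + 2) → E) :
    (ceDifferential (fun x y => (cocycleExtension 𝒜 br ω).l 2 ![x, y])
      (fun x f => (cocycleExtension 𝒜 br ω).l 2 ![x, f]) q θ p
      (fun i => LinearMap.inl ℝ E ℝ (X i))).2 =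
    ceDifferential (fun x y => br x y) (fun _ _ => (0 : ℝ)) q
      ((LinearMap.snd ℝ E ℝ).compMultilinearMap
        (θ.compLinearMap fun _ => LinearMap.inl ℝ E ℝ)) p X := by
  simp only [ceDifferential, Prod.snd_add, Prod.snd_sum, Prod.smul_snd, cocycleExtension_l_two]
  congr 1
  refine Finset.sum_congr rfl fun i _ => Finset.sum_congr rfl fun j _ => ?_
  congr 1
  change (θ _).2 = (θ _).2
  congr 2
  funext k
  refine Fin.cases ?_ (fun k => ?_) k <;> rfl

theorem isCoboundary_of_isExact_cocycleExtension
    (h : LInfinityData.IsExact 1 (cocycleExtension 𝒜 br ω)) : IsCoboundary 𝒜 br ω := by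
  obtain ⟨-, -, θ₀, θ₁, h₀, h₁, hd⟩ := h
  refine ⟨_, _, h₀.snd_comp_inl, h₁.snd_comp_inl, fun p X hX => ?_⟩
  have := congrArg Prod.snd (hd p (fun i => LinearMap.inl ℝ E ℝ (X i)) fun i => by
    rw [cocycleExtension_grading_zero]
    exact ⟨hX i, rfl⟩)
  rw [Prod.snd_add, snd_ceDifferential_cocycleExtension, snd_ceDifferential_cocycleExtension]
    at this
  exact this

end Extension

/-! ### Alternative laws in a normed division algebra -/

namespace NormedDivisionAlgebra

variable {K : Type*} [NormedDivisionAlgebra K]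

theorem ip_star_star (a b : K) : ip (star a) (star b) = ip a b := by
  have h := ip_mul_eq_left a (star b) 1
  rw [mul_one, ← star_eq_conj, ip_comm (star b)] at h
  rw [← h, ← re_apply, re_mul_star]

theorem re_star_mul (a b : K) : re (star a * b) = ip a b := by
  rw [← ip_star_star, ← re_mul_star, star_star]

theorem ip_mul_left_comm (a b c : K) : ip (a * b) c = ip b (star a * c) := ip_mul_eq_left a b c

theorem ip_mul_right_comm (a b c : K) : ip (a * b) c = ip a (c * star b) := ip_mul_eq_right a b c

/-- Tested against an arbitrary `d`, adjointness turns the left side into the twice polarized norm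
identity `ip_mul_mul`. This is the source of the Clifford relations. -/
theorem star_mul_mul_add (a c b : K) :
    star a * (c * b) + star c * (a * b) = (2 * ip a c) • b := by
  refine ip_ext fun d => ?_
  have h := ip_mul_mul a d c b
  rw [map_add, LinearMap.add_apply, map_smul, LinearMap.smul_apply,
    ip_mul_left_comm (star a), ip_mul_left_comm (star c), star_star, star_star, smul_eq_mul,
    ip_comm b d, ← h, ip_comm (a * d)]

theorem mul_star_mul_add (a c b : K) :
    a * (star c * b) + c * (star a * b) = (2 * ip a c) • b := by
  have h := star_mul_mul_add (star a) (star c) b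
  rwa [star_star, star_star, ip_star_star] at h

/-- This right alternative law, needed for the three-spinor identity, is `ip_mul_mul` with both
right factors equal to `star a`. -/
theorem mul_star_mul_self (a b : K) : (b * star a) * a = normSq a • b := by
  refine ip_ext fun d => ?_
  have h := ip_mul_mul b (star a) d (star a)
  rw [map_smul, LinearMap.smul_apply, ip_mul_right_comm, smul_eq_mul, ← ip_self,
    ← ip_star_star a a]
  linarith

theorem mul_star_add (a b : K) : a * star b + b * star a = (2 * ip a b) • (1 : K) := by
  have := mul_star_mul_add a b 1
  rwa [mul_one, mul_one] at this

end NormedDivisionAlgebra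

namespace Superstring

open NormedDivisionAlgebra Matrix

variable {K : Type*} [NormedDivisionAlgebra K]

/-! ### Coordinates -/

theorem exists_eq_mkVec (A : Vec K) : ∃ (a d : ℝ) (y : K), A = mkVec a d y := by
  refine ⟨re (A.1 0 0), re (A.1 1 1), A.1 0 1, Vec.ext ?_⟩
  ext i j
  fin_cases i <;> fin_cases j
  · exact eq_re_smul_of_star_eq (A.star_apply 0 0)
  · rfl
  · exact (A.star_apply 0 1).symm
  · exact eq_re_smul_of_star_eq (A.star_apply 1 1)

theorem minkowski_mkVec_mkVec (a d a' d' : ℝ) (y y' : K) :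
    minkowski (mkVec a d y) (mkVec a' d' y') = ip y y' - (a * d' + a' * d) / 2 := by
  rw [minkowski_apply]
  simp [mkVec, re_mul_star, re_one, ip_comm y' y]
  ring

theorem minkowski_comm (A B : Vec K) : minkowski A B = minkowski B A := by
  rw [minkowski_apply, minkowski_apply]
  congr 2; abel

theorem gamma_mkVec (a d : ℝ) (y : K) (ψ : Spinor K) :
    gamma (mkVec a d y) ψ = ![a • ψ 0 + y * ψ 1, star y * ψ 0 + d • ψ 1] := by
  change (mkVec a d y).1 *ᵥ ψ = _
  ext i
  fin_cases i <;> simp [mkVec, Matrix.mulVec, dotProduct, Fin.sum_univ_two]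

/-- Trace reversal sends the diagonal `(a, d)` to `(-d, -a)`. Thus `γ̃` is `γ` of another vector,
and statements about `γ̃` reduce to statements about `γ`. -/
theorem gammaTilde_mkVec (a d : ℝ) (y : K) :
    gammaTilde (mkVec a d y) = gamma (mkVec (-d) (-a) y) := by
  refine LinearMap.ext fun ψ => ?_
  change traceReversal (mkVec a d y).1 *ᵥ ψ = (mkVec (-d) (-a) y).1 *ᵥ ψ
  congr 1
  ext i j
  fin_cases i <;> fin_cases j <;> simp [mkVec, traceReversal, Matrix.trace]

theorem spinorDot_eq_mkVec (ψ φ : Spinor K) :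
    spinorDot ψ φ = mkVec (-(2 * ip (ψ 1) (φ 1))) (-(2 * ip (ψ 0) (φ 0)))
      (ψ 0 * star (φ 1) + φ 0 * star (ψ 1)) := by
  have h0 := mul_star_add (ψ 0) (φ 0)
  have h1 := mul_star_add (ψ 1) (φ 1)
  refine Vec.ext ?_
  change (spinorDotFun ψ φ).1 = _
  rw [spinorDotFun_val]
  ext i j
  fin_cases i <;> fin_cases j <;>
    simp [mkVec, traceReversal, Matrix.trace, vecMulVec_apply, h0, h1, add_comm (_ * star (ψ 0))]

theorem pairing_eq (ψ φ : Spinor K) : pairing ψ φ = ip (ψ 0) (φ 0) + ip (ψ 1) (φ 1) := by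
  simp [pairing, dotProduct, Fin.sum_univ_two, re_star_mul]

theorem pairing_comm (ψ φ : Spinor K) : pairing ψ φ = pairing φ ψ := by
  rw [pairing_eq, pairing_eq, ip_comm, ip_comm (ψ 1)]

variable (K) in
/-- The pairing `Re(ψ†φ)` as a bilinear form. -/
noncomputable def pairingForm : LinearMap.BilinForm ℝ (Spinor K) :=
  LinearMap.mk₂ ℝ pairing
    (fun _ _ _ => by simp [pairing_eq]; ring)
    (fun _ _ _ => by simp [pairing_eq]; ring)
    (fun _ _ _ => by simp [pairing_eq]; ring)
    (fun _ _ _ => by simp [pairing_eq]; ring)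

theorem pairingForm_apply (ψ φ : Spinor K) : pairingForm K ψ φ = pairing ψ φ := rfl

theorem spinorDot_comm (ψ φ : Spinor K) : spinorDot ψ φ = spinorDot φ ψ := by
  rw [spinorDot_eq_mkVec, spinorDot_eq_mkVec, ip_comm, ip_comm (ψ 0), add_comm]

theorem minkowski_spinorDot (ψ φ : Spinor K) (A : Vec K) :
    minkowski (spinorDot ψ φ) A = pairing ψ (gamma A φ) := by
  obtain ⟨a, d, y, rfl⟩ := exists_eq_mkVec A
  rw [spinorDot_eq_mkVec, minkowski_mkVec_mkVec, pairing_eq, gamma_mkVec]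
  have h1 : ip (ψ 0 * star (φ 1)) y = ip (ψ 0) (y * φ 1) := by
    rw [ip_mul_right_comm, star_star]
  have h2 : ip (φ 0 * star (ψ 1)) y = ip (ψ 1) (star y * φ 0) := by
    rw [ip_mul_right_comm, star_star, ip_comm, ip_mul_left_comm]
  simp [h1, h2]
  ring

/-- Self-adjointness of `γ(A)` expresses the symmetry of `ψ · φ`, since both sides compute its
metric pairing with `A`. -/
theorem pairing_gamma (A : Vec K) (ψ φ : Spinor K) :
    pairing ψ (gamma A φ) = pairing (gamma A ψ) φ := by
  rw [← minkowski_spinorDot, spinorDot_comm, minkowski_spinorDot, pairing_comm]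

theorem pairing_gammaTilde (A : Vec K) (ψ φ : Spinor K) :
    pairing ψ (gammaTilde A φ) = pairing (gammaTilde A ψ) φ := by
  obtain ⟨a, d, y, rfl⟩ := exists_eq_mkVec A
  rw [gammaTilde_mkVec, pairing_gamma]

/-! ### The Clifford relations and the identity for three spinors -/

theorem gammaTilde_gamma_add (A B : Vec K) (ψ : Spinor K) :
    gammaTilde A (gamma B ψ) + gammaTilde B (gamma A ψ) = (2 * minkowski A B) • ψ := by
  obtain ⟨a, d, y, rfl⟩ := exists_eq_mkVec A
  obtain ⟨a', d', y', rfl⟩ := exists_eq_mkVec B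
  have h0 := mul_star_mul_add y y' (ψ 0)
  have h1 := star_mul_mul_add y y' (ψ 1)
  simp only [gammaTilde_mkVec, gamma_mkVec, minkowski_mkVec_mkVec]
  ext i
  fin_cases i
  · simp [mul_add, mul_smul_comm, smul_smul]
    linear_combination (norm := module) h0
  · simp [mul_add, mul_smul_comm, smul_smul]
    linear_combination (norm := module) h1

theorem gamma_gammaTilde_add (A B : Vec K) (ψ : Spinor K) :
    gamma A (gammaTilde B ψ) + gamma B (gammaTilde A ψ) = (2 * minkowski A B) • ψ := by
  obtain ⟨a, d, y, rfl⟩ := exists_eq_mkVec A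
  obtain ⟨a', d', y', rfl⟩ := exists_eq_mkVec B
  -- Trace reversal is an involutive isometry exchanging `γ` and `γ̃`, so this relation is the
  -- previous one for the reversed vectors.
  have h := gammaTilde_gamma_add (mkVec (-d) (-a) y) (mkVec (-d') (-a') y') ψ
  simp only [gammaTilde_mkVec, neg_neg] at h ⊢
  rw [h, minkowski_mkVec_mkVec, minkowski_mkVec_mkVec]
  congr 1; ring

/-- In the first coordinate `-2|ψ₁|²ψ₀` cancels against `2(ψ₀ψ₁*)ψ₁`, by the right alternative law;
the second coordinate is symmetric. -/
theorem gamma_spinorDot_self (ψ : Spinor K) : gamma (spinorDot ψ ψ) ψ = 0 := by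
  rw [spinorDot_eq_mkVec, gamma_mkVec]
  have h0 := mul_star_mul_self (ψ 1) (ψ 0)
  have h1 := mul_star_mul_self (ψ 0) (ψ 1)
  ext i
  fin_cases i
  · simp [add_mul, h0, ip_self]
    module
  · simp [add_mul, h1, ip_self]
    module

theorem gamma_spinorDot_cyclic (ψ φ χ : Spinor K) :
    gamma (spinorDot ψ φ) χ + gamma (spinorDot φ χ) ψ + gamma (spinorDot χ ψ) φ = 0 := by
  -- The cubic map `ψ ↦ (ψ·ψ)ψ` vanishes, so comparing its values at `a + b` and `a - b` isolates
  -- the part linear in `b`. Polarizing once more in `a` gives the trilinear identity.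
  have polar : ∀ a b : Spinor K,
      gamma (spinorDot a a) b + (2 : ℝ) • gamma (spinorDot a b) a = 0 := by
    intro a b
    have h1 := gamma_spinorDot_self (a + b)
    have h2 := gamma_spinorDot_self (a - b)
    have ha := gamma_spinorDot_self a
    have hb := gamma_spinorDot_self b
    simp only [map_add, map_sub, LinearMap.add_apply, LinearMap.sub_apply, ha, hb,
      spinorDot_comm b a] at h1 h2
    refine smul_right_injective _ (two_ne_zero (α := ℝ)) ?_
    simp only [smul_zero]
    linear_combination (norm := module) h1 - h2
  have h := polar (ψ + φ) χ
  have h1 := polar ψ χ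
  have h2 := polar φ χ
  simp only [map_add, LinearMap.add_apply, spinorDot_comm φ ψ] at h
  refine smul_right_injective _ (two_ne_zero (α := ℝ)) ?_
  simp only [smul_zero, spinorDot_comm χ ψ]
  linear_combination (norm := module) h - h1 - h2

/-- Pairing the three-spinor identity with `ξ` gives the cocycle condition on four spinors. -/
theorem minkowski_spinorDot_cyclic (ψ φ χ ξ : Spinor K) :
    minkowski (spinorDot ψ φ) (spinorDot χ ξ) + minkowski (spinorDot ψ χ) (spinorDot φ ξ)
      + minkowski (spinorDot φ χ) (spinorDot ψ ξ) = 0 := by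
  have h := congrArg (pairingForm K ξ) (gamma_spinorDot_cyclic ψ φ χ)
  simp only [map_add, map_zero, pairingForm_apply, ← minkowski_spinorDot] at h
  rw [minkowski_comm (spinorDot ξ χ), minkowski_comm (spinorDot ξ ψ),
    minkowski_comm (spinorDot ξ φ), spinorDot_comm ξ χ, spinorDot_comm ξ ψ, spinorDot_comm ξ φ,
    spinorDot_comm χ ψ] at h
  linarith

end Superstring

/-! ### Contractions with a metric -/

section Contraction

variable {ι V W : Type*} [Fintype ι] [DecidableEq ι] [AddCommGroup V] [Module ℝ V]
  [AddCommGroup W] [Module ℝ W] {B : LinearMap.BilinForm ℝ V}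

theorem LinearMap.BilinForm.sum_smul_dualBasis (hB : B.Nondegenerate) (b : Module.Basis ι ℝ V)
    (v : V) : ∑ i, B v (b i) • B.dualBasis hB b i = v := by
  simpa using (B.dualBasis hB b).sum_repr v

theorem LinearMap.BilinForm.sum_dualBasis_smul (hB : B.Nondegenerate) (hs : B.IsSymm)
    (b : Module.Basis ι ℝ V) (v : V) : ∑ i, B v (B.dualBasis hB b i) • b i = v := by
  have h := sum_smul_dualBasis hB (B.dualBasis hB b) v
  rwa [dualBasis_dualBasis hB hs] at h

/-- The contraction of a bilinear map with the metric does not depend on the order of the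
dual bases. -/
theorem LinearMap.BilinForm.sum_dualBasis_comm (hB : B.Nondegenerate) (hs : B.IsSymm)
    (b : Module.Basis ι ℝ V) (F : V →ₗ[ℝ] V →ₗ[ℝ] W) :
    ∑ i, F (B.dualBasis hB b i) (b i) = ∑ i, F (b i) (B.dualBasis hB b i) := by
  -- Expanding the dual basis makes both contractions sums against its Gram matrix, which is
  -- symmetric.
  have e : ∀ i, B.dualBasis hB b i = ∑ j, B (B.dualBasis hB b i) (B.dualBasis hB b j) • b j :=
    fun i => (sum_dualBasis_smul hB hs b _).symm
  have l : ∀ i, F (B.dualBasis hB b i) (b i) =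
      ∑ j, B (B.dualBasis hB b i) (B.dualBasis hB b j) • F (b j) (b i) := fun i => by
    conv_lhs => rw [e i]
    simp [LinearMap.sum_apply]
  have r : ∀ i, F (b i) (B.dualBasis hB b i) =
      ∑ j, B (B.dualBasis hB b i) (B.dualBasis hB b j) • F (b i) (b j) := fun i => by
    conv_lhs => rw [e i]
    simp
  rw [Finset.sum_congr rfl fun i _ => l i, Finset.sum_congr rfl fun i _ => r i, Finset.sum_comm]
  refine Finset.sum_congr rfl fun i _ => Finset.sum_congr rfl fun j _ => ?_
  rw [hs.eq]

/-- A skew endomorphism can be moved across the contraction with the metric. -/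
theorem LinearMap.BilinForm.sum_apply_dualBasis_of_skew (hB : B.Nondegenerate) (hs : B.IsSymm)
    (b : Module.Basis ι ℝ V) (F : V →ₗ[ℝ] V →ₗ[ℝ] W) {T : Module.End ℝ V}
    (hT : ∀ v w, B (T v) w = -B v (T w)) :
    ∑ i, F (b i) (T (B.dualBasis hB b i)) = -∑ i, F (T (b i)) (B.dualBasis hB b i) := by
  have l : ∀ i, F (b i) (T (B.dualBasis hB b i)) =
      -∑ j, B (B.dualBasis hB b i) (T (b j)) • F (b i) (B.dualBasis hB b j) := fun i => by
    conv_lhs => rw [← sum_smul_dualBasis hB b (T (B.dualBasis hB b i))]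
    simp [hT]
  have r : ∀ i, F (T (b i)) (B.dualBasis hB b i) =
      ∑ j, B (B.dualBasis hB b j) (T (b i)) • F (b j) (B.dualBasis hB b i) := fun i => by
    conv_lhs => rw [← sum_dualBasis_smul hB hs b (T (b i))]
    simp [LinearMap.sum_apply, hs.eq (B.dualBasis hB b _)]
  rw [Finset.sum_congr rfl fun i _ => l i, Finset.sum_congr rfl fun i _ => r i,
    Finset.sum_neg_distrib, Finset.sum_comm]

end Contraction

namespace Superstring

open NormedDivisionAlgebra Matrix

variable {K : Type*} [NormedDivisionAlgebra K]

/-! ### The spin representation -/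

theorem minkowski_isSymm : (minkowski (K := K)).IsSymm := ⟨minkowski_comm⟩

theorem Lorentz.skew (T : Lorentz K) (v w : Vec K) :
    minkowski (T.1 v) w = -minkowski v (T.1 w) := by
  have h := (LinearMap.mem_skewAdjointSubmodule _).1 T.2 v w
  simpa using h

variable (K) in
/-- A basis of `V`. -/
noncomputable abbrev vecBasis := Module.finBasis ℝ (Vec K)

variable (K) in
/-- The basis of `V` dual to `vecBasis` with respect to the metric. -/
noncomputable abbrev vecDual :=
  (minkowski (K := K)).dualBasis minkowski_nondegenerate (vecBasis K)

variable (K) in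
/-- The action `γ̃(A)γ(B)` of a product of two vectors on `S₊`. -/
noncomputable def cliffordPlus : Vec K →ₗ[ℝ] Vec K →ₗ[ℝ] Module.End ℝ (Spinor K) :=
  (LinearMap.mul ℝ (Module.End ℝ (Spinor K))).compl₁₂ gammaTilde gamma

variable (K) in
/-- The action `γ(A)γ̃(B)` of a product of two vectors on `S₋`. -/
noncomputable def cliffordMinus : Vec K →ₗ[ℝ] Vec K →ₗ[ℝ] Module.End ℝ (Spinor K) :=
  (LinearMap.mul ℝ (Module.End ℝ (Spinor K))).compl₁₂ gamma gammaTilde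

theorem cliffordPlus_apply (A B : Vec K) (ψ : Spinor K) :
    cliffordPlus K A B ψ = gammaTilde A (gamma B ψ) := rfl

theorem cliffordMinus_apply (A B : Vec K) (ψ : Spinor K) :
    cliffordMinus K A B ψ = gamma A (gammaTilde B ψ) := rfl

theorem spinAction_eq (T : Lorentz K) :
    spinAction T = (1 / 4 : ℝ) • ∑ i, cliffordPlus K (T.1 (vecBasis K i)) (vecDual K i) := by
  refine LinearMap.ext fun ψ => ?_
  simp [spinAction, LinearMap.sum_apply, cliffordPlus_apply]

/-- The action of the Lorentz algebra on `S₋`. -/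
noncomputable def spinActionMinus (T : Lorentz K) : Module.End ℝ (Spinor K) :=
  (1 / 4 : ℝ) • ∑ i, cliffordMinus K (T.1 (vecBasis K i)) (vecDual K i)

theorem sum_minkowski_smul (T : Lorentz K) (A : Vec K) :
    ∑ i, minkowski A (T.1 (vecBasis K i)) • vecDual K i = -T.1 A := by
  have h := LinearMap.BilinForm.sum_smul_dualBasis minkowski_nondegenerate (vecBasis K) (T.1 A)
  rw [← h, ← Finset.sum_neg_distrib]
  refine Finset.sum_congr rfl fun i _ => ?_
  rw [T.skew]
  module

theorem sum_minkowski_smul_apply (T : Lorentz K) (A : Vec K) :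
    ∑ i, minkowski A (vecDual K i) • T.1 (vecBasis K i) = T.1 A := by
  have h := LinearMap.BilinForm.sum_dualBasis_smul minkowski_nondegenerate minkowski_isSymm
    (vecBasis K) A
  conv_rhs => rw [← h]
  simp

/-- Two Clifford relations move `γ(A)` through `γ(T eᵢ)γ̃(eⁱ)`. The leftover terms contract to
`2γ(TA)` each, using skewness of `T` for one of them; the sum `4γ(TA)` explains the factor `1/4` in
the spin action. -/
theorem spinActionMinus_gamma (T : Lorentz K) (A : Vec K) (ψ : Spinor K) :
    spinActionMinus T (gamma A ψ) = gamma A (spinAction T ψ) + gamma (T.1 A) ψ := by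
  have key : ∀ i, cliffordMinus K (T.1 (vecBasis K i)) (vecDual K i) (gamma A ψ) =
      gamma A (cliffordPlus K (T.1 (vecBasis K i)) (vecDual K i) ψ)
        + ((2 : ℝ) • gamma (minkowski A (vecDual K i) • T.1 (vecBasis K i)) ψ
          - (2 : ℝ) • gamma (minkowski A (T.1 (vecBasis K i)) • vecDual K i) ψ) := by
    intro i
    have h1 := gammaTilde_gamma_add A (vecDual K i) ψ
    have h2 := gamma_gammaTilde_add A (T.1 (vecBasis K i)) (gamma (vecDual K i) ψ)
    have h3 := congrArg (gamma (T.1 (vecBasis K i))) h1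
    rw [map_add, map_smul] at h3
    simp only [cliffordMinus_apply, cliffordPlus_apply, map_smul, LinearMap.smul_apply]
    linear_combination (norm := module) h3 - h2
  have hs : ∑ i, gamma (minkowski A (vecDual K i) • T.1 (vecBasis K i)) ψ = gamma (T.1 A) ψ := by
    rw [← LinearMap.sum_apply, ← map_sum, sum_minkowski_smul_apply]
  have ht : ∑ i, gamma (minkowski A (T.1 (vecBasis K i)) • vecDual K i) ψ
      = -gamma (T.1 A) ψ := by
    rw [← LinearMap.sum_apply, ← map_sum, sum_minkowski_smul, map_neg, LinearMap.neg_apply]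
  rw [spinActionMinus, spinAction_eq, LinearMap.smul_apply, LinearMap.smul_apply,
    LinearMap.sum_apply, LinearMap.sum_apply, map_smul, map_sum,
    Finset.sum_congr rfl fun i _ => key i, Finset.sum_add_distrib, Finset.sum_sub_distrib,
    ← Finset.smul_sum, ← Finset.smul_sum, hs, ht]
  module

theorem spinAction_gammaTilde (T : Lorentz K) (A : Vec K) (ψ : Spinor K) :
    spinAction T (gammaTilde A ψ)
      = gammaTilde A (spinActionMinus T ψ) + gammaTilde (T.1 A) ψ := by
  have key : ∀ i, cliffordPlus K (T.1 (vecBasis K i)) (vecDual K i) (gammaTilde A ψ) =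
      gammaTilde A (cliffordMinus K (T.1 (vecBasis K i)) (vecDual K i) ψ)
        + ((2 : ℝ) • gammaTilde (minkowski A (vecDual K i) • T.1 (vecBasis K i)) ψ
          - (2 : ℝ) • gammaTilde (minkowski A (T.1 (vecBasis K i)) • vecDual K i) ψ) := by
    intro i
    have h1 := gamma_gammaTilde_add A (vecDual K i) ψ
    have h2 := gammaTilde_gamma_add A (T.1 (vecBasis K i)) (gammaTilde (vecDual K i) ψ)
    have h3 := congrArg (gammaTilde (T.1 (vecBasis K i))) h1
    rw [map_add, map_smul] at h3
    simp only [cliffordMinus_apply, cliffordPlus_apply, map_smul, LinearMap.smul_apply]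
    linear_combination (norm := module) h3 - h2
  have hs : ∑ i, gammaTilde (minkowski A (vecDual K i) • T.1 (vecBasis K i)) ψ
      = gammaTilde (T.1 A) ψ := by
    rw [← LinearMap.sum_apply, ← map_sum, sum_minkowski_smul_apply]
  have ht : ∑ i, gammaTilde (minkowski A (T.1 (vecBasis K i)) • vecDual K i) ψ
      = -gammaTilde (T.1 A) ψ := by
    rw [← LinearMap.sum_apply, ← map_sum, sum_minkowski_smul, map_neg, LinearMap.neg_apply]
  rw [spinActionMinus, spinAction_eq, LinearMap.smul_apply, LinearMap.smul_apply,
    LinearMap.sum_apply, LinearMap.sum_apply, map_smul, map_sum,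
    Finset.sum_congr rfl fun i _ => key i, Finset.sum_add_distrib, Finset.sum_sub_distrib,
    ← Finset.smul_sum, ← Finset.smul_sum, hs, ht]
  module

/-- By the two intertwining relations, `T` acts on the operators `γ̃(A)γ(B)` as a derivation; this
is applied to the contraction defining the action of `T'`. -/
theorem spinAction_lorentzBracket (T T' : Lorentz K) (ψ : Spinor K) :
    spinAction (lorentzBracket T T') ψ
      = spinAction T (spinAction T' ψ) - spinAction T' (spinAction T ψ) := by
  have key : ∀ A B : Vec K, spinAction T (cliffordPlus K A B ψ) =
      cliffordPlus K A B (spinAction T ψ) + cliffordPlus K (T.1 A) B ψ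
        + cliffordPlus K A (T.1 B) ψ := by
    intro A B
    simp only [cliffordPlus_apply]
    rw [spinAction_gammaTilde, spinActionMinus_gamma, map_add]
    abel
  -- The terms with `T` on the dual basis become minus the contraction for `T' T`, completing the
  -- commutator.
  have hsk := LinearMap.BilinForm.sum_apply_dualBasis_of_skew minkowski_nondegenerate
    minkowski_isSymm (vecBasis K) ((cliffordPlus K).comp T'.1) T.skew
  have hsk' := congrArg (fun f : Module.End ℝ (Spinor K) => f ψ) hsk
  simp only [LinearMap.comp_apply, LinearMap.neg_apply, LinearMap.sum_apply] at hsk'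
  rw [spinAction_eq T', spinAction_eq (lorentzBracket T T')]
  simp only [LinearMap.smul_apply, LinearMap.sum_apply, map_smul, map_sum, key,
    Finset.sum_add_distrib, hsk', lorentzBracket, Ring.lie_def, LinearMap.sub_apply,
    Module.End.mul_apply, map_sub, Finset.sum_sub_distrib]
  module

/-- The adjoint of `γ̃(A)γ(B)` is `γ(B)γ̃(A)`. The reversed order is undone by symmetry of the
contraction, and skewness of `T` supplies the sign. -/
theorem pairing_spinAction (T : Lorentz K) (ψ φ : Spinor K) :
    pairing (spinAction T ψ) φ = -pairing ψ (spinActionMinus T φ) := by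
  have e : ∀ A B : Vec K, pairingForm K (cliffordPlus K A B ψ) φ
      = pairingForm K ψ (cliffordMinus K B A φ) := fun A B => by
    simp only [cliffordPlus_apply, cliffordMinus_apply, pairingForm_apply]
    rw [← pairing_gammaTilde, ← pairing_gamma]
  have hsk := LinearMap.BilinForm.sum_apply_dualBasis_of_skew minkowski_nondegenerate
    minkowski_isSymm (vecBasis K) (cliffordMinus K).flip T.skew
  have hc := LinearMap.BilinForm.sum_dualBasis_comm minkowski_nondegenerate minkowski_isSymm
    (vecBasis K) ((cliffordMinus K).comp T.1)
  simp only [LinearMap.flip_apply, LinearMap.comp_apply] at hsk hc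
  rw [← pairingForm_apply, ← pairingForm_apply, spinAction_eq, spinActionMinus, ← hc, hsk]
  simp only [LinearMap.smul_apply, LinearMap.sum_apply, LinearMap.neg_apply, map_smul, map_sum,
    map_neg, e]
  simp

theorem minkowski_spinorDot_spinAction (T : Lorentz K) (ψ φ : Spinor K) (A : Vec K) :
    minkowski (spinorDot (spinAction T ψ) φ) A + minkowski (spinorDot ψ (spinAction T φ)) A
      + minkowski (spinorDot ψ φ) (T.1 A) = 0 := by
  have h := congrArg (pairingForm K ψ) (spinActionMinus_gamma T A φ)
  rw [map_add] at h
  simp only [pairingForm_apply] at h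
  rw [minkowski_spinorDot, minkowski_spinorDot, minkowski_spinorDot, pairing_spinAction, h]
  ring

/-- Invariance of `g(ψ·φ, A)` becomes equivariance of the bracket because the metric is
nondegenerate. It is the Jacobi identity for a Lorentz element and two spinors. -/
theorem apply_spinorDot (T : Lorentz K) (ψ φ : Spinor K) :
    T.1 (spinorDot ψ φ) = spinorDot (spinAction T ψ) φ + spinorDot ψ (spinAction T φ) := by
  refine sub_eq_zero.1 (minkowski_nondegenerate.1 _ fun A => ?_)
  have h := minkowski_spinorDot_spinAction T ψ φ A
  rw [map_sub, LinearMap.sub_apply, map_add, LinearMap.add_apply, T.skew]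
  linarith

end Superstring

namespace Superstring

open NormedDivisionAlgebra Matrix

variable {K : Type*} [NormedDivisionAlgebra K]

/-! ### The Poincaré superalgebra -/

theorem mem_sisoGrading_zero {x : Siso K} : x ∈ sisoGrading K 0 ↔ x.2.2 = 0 := by
  simp [sisoGrading, Submodule.mem_prod]

theorem mem_sisoGrading_one {x : Siso K} : x ∈ sisoGrading K 1 ↔ x.1 = 0 ∧ x.2.1 = 0 := by
  simp [sisoGrading, Submodule.mem_prod]

theorem sisoBracket_apply (x y : Siso K) :
    sisoBracket K x y = (lorentzBracket x.1 y.1,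
      x.1.1 y.2.1 - y.1.1 x.2.1 + spinorDot x.2.2 y.2.2,
      spinAction x.1 y.2.2 - spinAction y.1 x.2.2) := rfl

theorem lorentzBracket_zero_left (T : Lorentz K) : lorentzBracket 0 T = 0 :=
  Subtype.ext (by simp [lorentzBracket, Ring.lie_def])

theorem lorentzBracket_zero_right (T : Lorentz K) : lorentzBracket T 0 = 0 :=
  Subtype.ext (by simp [lorentzBracket, Ring.lie_def])

theorem lorentzBracket_skew (T T' : Lorentz K) : lorentzBracket T T' = -lorentzBracket T' T :=
  Subtype.ext (by simp [lorentzBracket, Ring.lie_def])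

theorem lorentzBracket_jacobi (T T' T'' : Lorentz K) :
    lorentzBracket T (lorentzBracket T' T'') =
      lorentzBracket (lorentzBracket T T') T'' + lorentzBracket T' (lorentzBracket T T'') :=
  Subtype.ext (by simp only [lorentzBracket, Ring.lie_def, Submodule.coe_add]; noncomm_ring)

theorem lorentzBracket_apply (T T' : Lorentz K) (v : Vec K) :
    (lorentzBracket T T').1 v = T.1 (T'.1 v) - T'.1 (T.1 v) := rfl

theorem isInternal_sisoGrading : DirectSum.IsInternal (sisoGrading K) := by
  rw [DirectSum.isInternal_submodule_iff_isCompl (sisoGrading K) (i := 0) (j := 1) (by decide)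
    (by ext p; simpa using parity_cases p)]
  constructor
  · rw [Submodule.disjoint_def]
    intro x hx hx'
    rw [mem_sisoGrading_zero] at hx
    rw [mem_sisoGrading_one] at hx'
    exact Prod.ext hx'.1 (Prod.ext hx'.2 hx)
  · rw [codisjoint_iff, eq_top_iff]
    intro x _
    refine Submodule.mem_sup.2 ⟨(x.1, x.2.1, 0), mem_sisoGrading_zero.2 rfl, (0, 0, x.2.2),
      mem_sisoGrading_one.2 ⟨rfl, rfl⟩, ?_⟩
    simp

theorem isLieSuperalgebra_siso : IsLieSuperalgebra (sisoGrading K) (sisoBracket K) where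
  isInternal := isInternal_sisoGrading
  bracket_mem {p q x y} hx hy := by
    rcases parity_cases p with rfl | rfl <;> rcases parity_cases q with rfl | rfl
    · rw [mem_sisoGrading_zero] at hx hy
      rw [add_zero, mem_sisoGrading_zero, sisoBracket_apply]
      simp [hx, hy]
    · rw [mem_sisoGrading_zero] at hx
      rw [mem_sisoGrading_one] at hy
      rw [zero_add, mem_sisoGrading_one, sisoBracket_apply]
      simp [hx, hy, lorentzBracket_zero_right]
    · rw [mem_sisoGrading_one] at hx
      rw [mem_sisoGrading_zero] at hy
      rw [add_zero, mem_sisoGrading_one, sisoBracket_apply]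
      simp [hx, hy, lorentzBracket_zero_left]
    · rw [mem_sisoGrading_one] at hx hy
      rw [show (1 : ZMod 2) + 1 = 0 by decide, mem_sisoGrading_zero, sisoBracket_apply]
      simp [hx, hy]
  skew {p q x y} hx hy := by
    rcases parity_cases p with rfl | rfl <;> rcases parity_cases q with rfl | rfl <;>
      simp only [mem_sisoGrading_zero, mem_sisoGrading_one] at hx hy <;>
      simp only [sisoBracket_apply, mul_zero, mul_one, paritySign_zero,
        paritySign_one, one_smul, hx, hy, lorentzBracket_zero_left, lorentzBracket_zero_right,
        map_zero, LinearMap.zero_apply, ZeroMemClass.coe_zero]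
    · rw [lorentzBracket_skew]; simp
    · simp
    · simp
    · simp [spinorDot_comm y.2.2]
  jacobi {p q x y} hx hy z := by
    rcases parity_cases p with rfl | rfl <;> rcases parity_cases q with rfl | rfl <;>
      simp only [mem_sisoGrading_zero, mem_sisoGrading_one] at hx hy <;>
      simp only [sisoBracket_apply, mul_zero, mul_one, paritySign_zero,
        paritySign_one, one_smul, hx, hy, lorentzBracket_zero_left, lorentzBracket_zero_right,
        map_zero, LinearMap.zero_apply, ZeroMemClass.coe_zero, sub_zero, zero_sub, zero_add,
        add_zero, neg_zero, Prod.mk_add_mk, map_neg, map_sub, LinearMap.neg_apply,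
        lorentzBracket_apply, spinAction_lorentzBracket, apply_spinorDot]
    · refine Prod.ext (lorentzBracket_jacobi _ _ _) (Prod.ext ?_ ?_)
      · dsimp only; abel
      · dsimp only; abel
    · refine Prod.ext rfl (Prod.ext ?_ ?_)
      · rfl
      · dsimp only; abel
    · refine Prod.ext rfl (Prod.ext ?_ ?_)
      · dsimp only; rw [spinorDot_comm x.2.2]; abel
      · dsimp only; abel
    · refine Prod.ext ?_ (Prod.ext ?_ ?_)
      · simp
      · simp [spinorDot_comm y.2.2]
      · simp

/-! ### The cocycle -/

theorem alpha_apply (x : Fin 3 → Siso K) :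
    alpha K x = minkowski (spinorDot (x 0).2.2 (x 1).2.2) (x 2).2.1
      - minkowski (spinorDot (x 0).2.2 (x 2).2.2) (x 1).2.1
      + minkowski (spinorDot (x 1).2.2 (x 2).2.2) (x 0).2.1 := rfl

/-- On homogeneous triples the form can be nonzero only for two spinors and one even entry. The skew
law is then a check over eight parity patterns and six permutations, using the symmetry of `ψ · φ`.
-/
theorem isCochain_alpha : IsCochain (sisoGrading K) evenLine 0 (alpha K) where
  skew σ p X hX := by
    have h0 := hX 0
    have h1 := hX 1
    have h2 := hX 2
    rw [alpha_apply, alpha_apply, chiSign]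
    rcases parity_cases (p 0) with e0 | e0 <;> rcases parity_cases (p 1) with e1 | e1 <;>
      rcases parity_cases (p 2) with e2 | e2 <;> rw [e0] at h0 <;> rw [e1] at h1 <;>
      rw [e2] at h2 <;> simp only [mem_sisoGrading_zero, mem_sisoGrading_one] at h0 h1 h2 <;>
      rcases perm_fin_three_eq σ with rfl | rfl | rfl | rfl | rfl | rfl <;>
      simp [koszulSign, Fin.prod_univ_three, Equiv.swap_apply_def, h0, h1, h2, e0, e1, e2,
        paritySign_zero, paritySign_one, Equiv.Perm.sign_swap', spinorDot_comm (X 1).2.2,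
        spinorDot_comm (X 2).2.2 (X 0).2.2]
  parity p X hX := by
    have h0 := hX 0
    have h1 := hX 1
    have h2 := hX 2
    rw [alpha_apply, add_zero, Fin.sum_univ_three]
    rcases parity_cases (p 0) with e0 | e0 <;> rcases parity_cases (p 1) with e1 | e1 <;>
      rcases parity_cases (p 2) with e2 | e2 <;> rw [e0] at h0 ⊢ <;> rw [e1] at h1 ⊢ <;>
      rw [e2] at h2 ⊢ <;> simp only [mem_sisoGrading_zero, mem_sisoGrading_one] at h0 h1 h2 <;>
      simp [h0, h1, h2, evenLine_zero, show (1 : ZMod 2) + 1 = 0 by decide]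

theorem alpha_vec (x y z : Siso K) :
    alpha K ![x, y, z] = minkowski (spinorDot x.2.2 y.2.2) z.2.1
      - minkowski (spinorDot x.2.2 z.2.2) y.2.1 + minkowski (spinorDot y.2.2 z.2.2) x.2.1 := rfl

theorem isEvenCocycle_alpha : IsEvenCocycle (sisoGrading K) (sisoBracket K) (alpha K) := by
  refine ⟨isCochain_alpha, fun (p : Fin 4 → ZMod 2) (X : Fin 4 → Siso K) hX => ?_⟩
  have h0 := hX 0
  have h1 := hX 1
  have h2 := hX 2
  have h3 := hX 3
  have inv : ∀ i j k l, minkowski (spinorDot (spinAction (X i).1 (X k).2.2) (X l).2.2) (X j).2.1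
      + minkowski (spinorDot (spinAction (X i).1 (X l).2.2) (X k).2.2) (X j).2.1
      + minkowski (spinorDot (X k).2.2 (X l).2.2) ((X i).1.1 (X j).2.1) = 0 := fun i j k l => by
    rw [spinorDot_comm _ (X k).2.2]
    exact minkowski_spinorDot_spinAction _ _ _ _
  refine (ceDifferential_three _ 0 (fun v : Fin 3 → Siso K => alpha K v) p X).trans ?_
  simp only [alpha_vec, sisoBracket_apply]
  rcases parity_cases (p 0) with e0 | e0 <;> rcases parity_cases (p 1) with e1 | e1 <;>
    rcases parity_cases (p 2) with e2 | e2 <;> rcases parity_cases (p 3) with e3 | e3 <;>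
    rw [e0] at h0 <;> rw [e1] at h1 <;> rw [e2] at h2 <;> rw [e3] at h3 <;>
    simp only [mem_sisoGrading_zero, mem_sisoGrading_one] at h0 h1 h2 h3 <;>
    simp [h0, h1, h2, h3, e0, e1, e2, e3, paritySign_zero, paritySign_one]
  -- Each pattern with two even entries and two spinors is the sum of two invariance statements, one
  -- for the Lorentz part of each even entry acting on the vector part of the other.
  · linarith [inv 0 1 2 3, inv 1 0 2 3]
  · linarith [inv 0 2 1 3, inv 2 0 1 3]
  · linarith [inv 0 3 1 2, inv 3 0 1 2]
  · linarith [inv 1 2 0 3, inv 2 1 0 3]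
  · linarith [inv 1 3 0 2, inv 3 1 0 2]
  · linarith [inv 2 3 0 1, inv 3 2 0 1]
  · have h := minkowski_spinorDot_cyclic (X 0).2.2 (X 1).2.2 (X 2).2.2 (X 3).2.2
    rw [minkowski_comm (spinorDot (X 2).2.2 _), minkowski_comm (spinorDot (X 1).2.2 (X 3).2.2),
      minkowski_comm (spinorDot (X 1).2.2 (X 2).2.2)]
    rw [minkowski_comm (spinorDot (X 1).2.2 (X 2).2.2)] at h
    linarith

theorem not_isCoboundary_alpha : ¬ IsCoboundary (sisoGrading K) (sisoBracket K) (alpha K) := by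
  rintro ⟨θ₀, θ₁, h₀, h₁, h⟩
  -- For these spinors `ψ · φ` is the vector with zero diagonal and off-diagonal entry `1`, a unit
  -- spacelike vector.
  let ψ : Spinor K := ![1, 0]
  let φ : Spinor K := ![0, 1]
  let A : Vec K := spinorDot ψ φ
  have hA : minkowski A A = 1 := by
    simp only [A, spinorDot_eq_mkVec, minkowski_mkVec_mkVec]
    simp [ψ, φ, ip_self, normSq_one]
  let X : Fin 3 → Siso K := ![(0, 0, ψ), (0, 0, φ), (0, A, 0)]
  have hX : ∀ i, X i ∈ sisoGrading K (![1, 1, 0] i) := by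
    intro i
    fin_cases i
    · exact mem_sisoGrading_one.2 ⟨rfl, rfl⟩
    · exact mem_sisoGrading_one.2 ⟨rfl, rfl⟩
    · exact mem_sisoGrading_zero.2 rfl
  have h01 : sisoBracket K (X 0) (X 1) = (0, A, 0) := by
    simp [X, sisoBracket_apply, A, lorentzBracket_zero_left]
  have h02 : sisoBracket K (X 0) (X 2) = 0 := by
    simp [X, sisoBracket_apply, lorentzBracket_zero_left]
  have h12 : sisoBracket K (X 1) (X 2) = 0 := by
    simp [X, sisoBracket_apply, lorentzBracket_zero_left]
  have hd : ∀ (q : ZMod 2) (θ : MultilinearMap ℝ (fun _ : Fin 2 => Siso K) ℝ),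
      IsCochain (sisoGrading K) evenLine q θ →
      ceDifferential (fun x y => sisoBracket K x y) (fun _ _ => (0 : ℝ)) q θ ![1, 1, 0] X = 0 := by
    intro q θ hθ
    have hz : ∀ x : Siso K, θ ![0, x] = 0 := fun x => θ.map_coord_zero 0 rfl
    -- Vectors commute with spinors, so only the term `θ(ψ·φ, A) = θ(A, A)` survives in `dθ`.
    -- Exchanging two even entries changes its sign, hence it is zero for `θ` of either parity.
    have hs := hθ.skew (Equiv.swap 0 1) ![0, 0] ![(0, A, 0), (0, A, 0)] (by
      intro i
      fin_cases i <;> exact mem_sisoGrading_zero.2 rfl)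
    have e : (fun i => (![(0, A, 0), (0, A, 0)] : Fin 2 → Siso K) (Equiv.swap 0 1 i))
        = ![(0, A, 0), (0, A, 0)] := by
      funext i; fin_cases i <;> rfl
    rw [e, chiSign_swap_fin_two] at hs
    simp only [Matrix.cons_val_zero, zero_mul, paritySign_zero, neg_smul, one_smul] at hs
    rw [ceDifferential_two, h01, h02, h12, hz, hz, show X 2 = (0, A, 0) from rfl,
      self_eq_neg.1 hs]
    simp
  have := h ![1, 1, 0] X hX
  erw [hd 0 θ₀ h₀, hd 1 θ₁ h₁] at this
  have hα : alpha K X = minkowski A A := by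
    simp [X, alpha_vec, A]
  rw [hα, hA] at this
  norm_num at this

end Superstring

/-! ### Normed division algebras of dimension 1, 2, 4 and 8 -/

section Existence

open scoped Quaternion

/-- The squared norm of a real inner product space as a quadratic form. -/
noncomputable def normSqForm (A : Type*) [NormedAddCommGroup A] [InnerProductSpace ℝ A] :
    QuadraticForm ℝ A :=
  LinearMap.BilinMap.toQuadraticMap (innerₗ A)

theorem normSqForm_apply {A : Type*} [NormedAddCommGroup A] [InnerProductSpace ℝ A] (a : A) :
    normSqForm A a = ‖a‖ ^ 2 := by
  simp [normSqForm]

theorem normSqForm_posDef (A : Type*) [NormedAddCommGroup A] [InnerProductSpace ℝ A] :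
    (normSqForm A).PosDef := fun a ha => by
  rw [normSqForm_apply]
  have := norm_pos_iff.2 ha
  positivity

/-- The real numbers as a normed division algebra. -/
noncomputable abbrev realNormedDivisionAlgebra : NormedDivisionAlgebra ℝ where
  normSq := normSqForm ℝ
  normSq_posDef := normSqForm_posDef ℝ
  normSq_mul a b := by simp only [normSqForm_apply, norm_mul, mul_pow]

/-- The complex numbers as a normed division algebra. -/
noncomputable abbrev complexNormedDivisionAlgebra : NormedDivisionAlgebra ℂ where
  normSq := normSqForm ℂ
  normSq_posDef := normSqForm_posDef ℂ
  normSq_mul a b := by simp only [normSqForm_apply, norm_mul, mul_pow]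

/-- The quaternions as a normed division algebra. -/
noncomputable abbrev quaternionNormedDivisionAlgebra : NormedDivisionAlgebra ℍ[ℝ] where
  normSq := normSqForm ℍ[ℝ]
  normSq_posDef := normSqForm_posDef ℍ[ℝ]
  normSq_mul a b := by simp only [normSqForm_apply, norm_mul, mul_pow]

/-- The octonions, by the Cayley–Dickson construction from the quaternions. -/
def Octonion : Type := ℍ[ℝ] × ℍ[ℝ]

namespace Octonion

noncomputable instance : AddCommGroup Octonion := inferInstanceAs (AddCommGroup (ℍ[ℝ] × ℍ[ℝ]))

noncomputable instance : Module ℝ Octonion := inferInstanceAs (Module ℝ (ℍ[ℝ] × ℍ[ℝ]))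

noncomputable instance : Mul Octonion :=
  ⟨fun x y => (x.1 * y.1 - star y.2 * x.2, y.2 * x.1 + x.2 * star y.1)⟩

noncomputable instance : One Octonion := ⟨((1 : ℍ[ℝ]), (0 : ℍ[ℝ]))⟩

theorem ext {x y : Octonion} (h₁ : x.1 = y.1) (h₂ : x.2 = y.2) : x = y := Prod.ext h₁ h₂

theorem add_fst (x y : Octonion) : (x + y).1 = x.1 + y.1 := rfl

theorem add_snd (x y : Octonion) : (x + y).2 = x.2 + y.2 := rfl

theorem smul_fst (r : ℝ) (x : Octonion) : (r • x).1 = r • x.1 := rfl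

theorem smul_snd (r : ℝ) (x : Octonion) : (r • x).2 = r • x.2 := rfl

theorem zero_fst : (0 : Octonion).1 = 0 := rfl

theorem zero_snd : (0 : Octonion).2 = 0 := rfl

theorem one_fst : (1 : Octonion).1 = 1 := rfl

theorem one_snd : (1 : Octonion).2 = 0 := rfl

theorem mul_fst (x y : Octonion) : (x * y).1 = x.1 * y.1 - star y.2 * x.2 := rfl

theorem mul_snd (x y : Octonion) : (x * y).2 = y.2 * x.1 + x.2 * star y.1 := rfl

noncomputable instance : NonAssocRing Octonion where
  left_distrib x y z := by
    apply ext <;> simp only [add_fst, add_snd, mul_fst, mul_snd, star_add] <;> noncomm_ring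
  right_distrib x y z := by
    apply ext <;> simp only [add_fst, add_snd, mul_fst, mul_snd] <;> noncomm_ring
  zero_mul x := by apply ext <;> simp [mul_fst, mul_snd, zero_fst, zero_snd]
  mul_zero x := by apply ext <;> simp [mul_fst, mul_snd, zero_fst, zero_snd]
  one_mul x := by apply ext <;> simp [mul_fst, mul_snd, one_fst, one_snd]
  mul_one x := by apply ext <;> simp [mul_fst, mul_snd, one_fst, one_snd]

/-- The squared norm of an octonion. -/
noncomputable def normSq : QuadraticForm ℝ Octonion :=
  QuadraticMap.prod (normSqForm ℍ[ℝ]) (normSqForm ℍ[ℝ])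

theorem normSq_apply (x : Octonion) :
    normSq x = Quaternion.normSq x.1 + Quaternion.normSq x.2 := by
  rw [Quaternion.normSq_eq_norm_mul_self, Quaternion.normSq_eq_norm_mul_self, ← pow_two,
    ← pow_two, ← normSqForm_apply, ← normSqForm_apply]
  rfl

/-- This is an eight-square identity: in the sixteen real coordinates both sides are the same
polynomial. -/
theorem normSq_mul (x y : Octonion) : normSq (x * y) = normSq x * normSq y := by
  simp only [normSq_apply, mul_fst, mul_snd, Quaternion.normSq_def', Quaternion.re_sub,
    Quaternion.imI_sub, Quaternion.imJ_sub, Quaternion.imK_sub, Quaternion.re_add,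
    Quaternion.imI_add, Quaternion.imJ_add, Quaternion.imK_add, Quaternion.re_mul,
    Quaternion.imI_mul, Quaternion.imJ_mul, Quaternion.imK_mul, Quaternion.re_star,
    Quaternion.imI_star, Quaternion.imJ_star, Quaternion.imK_star]
  ring

end Octonion

/-- The octonions as a normed division algebra. -/
noncomputable abbrev octonionNormedDivisionAlgebra : NormedDivisionAlgebra Octonion where
  smul_assoc r x y := by
    apply Octonion.ext <;>
      simp [Octonion.mul_fst, Octonion.mul_snd, Octonion.smul_fst, Octonion.smul_snd, smul_sub]
  smul_comm r x y := by
    apply Octonion.ext <;>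
      simp [Octonion.mul_fst, Octonion.mul_snd, Octonion.smul_fst, Octonion.smul_snd, smul_sub]
  toFinite := inferInstanceAs (Module.Finite ℝ (ℍ[ℝ] × ℍ[ℝ]))
  exists_pair_ne := ⟨0, 1, fun h => zero_ne_one (congrArg Prod.fst h)⟩
  normSq := Octonion.normSq
  normSq_posDef := (normSqForm_posDef ℍ[ℝ]).prod (normSqForm_posDef ℍ[ℝ])
  normSq_mul := Octonion.normSq_mul

theorem exists_normedDivisionAlgebra {n : ℕ} (hn : n = 1 ∨ n = 2 ∨ n = 4 ∨ n = 8) :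
    ∃ (K : Type) (_ : NormedDivisionAlgebra K), Module.finrank ℝ K = n := by
  rcases hn with rfl | rfl | rfl | rfl
  · exact ⟨ℝ, realNormedDivisionAlgebra, Module.finrank_self ℝ⟩
  · exact ⟨ℂ, complexNormedDivisionAlgebra, Complex.finrank_real_complex⟩
  · exact ⟨ℍ[ℝ], quaternionNormedDivisionAlgebra, Quaternion.finrank_eq_four⟩
  · refine ⟨Octonion, octonionNormedDivisionAlgebra, ?_⟩
    change Module.finrank ℝ (ℍ[ℝ] × ℍ[ℝ]) = 8
    rw [Module.finrank_prod, Quaternion.finrank_eq_four]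

end Existence

/-! ### The dimension of the space of vectors -/

namespace Superstring

open NormedDivisionAlgebra

variable (K : Type*) [NormedDivisionAlgebra K]

/-- A hermitian matrix is given by its real diagonal entries and an off-diagonal entry. -/
noncomputable def vecEquiv : Vec K ≃ₗ[ℝ] ℝ × ℝ × K where
  toFun A := (re (A.1 0 0), re (A.1 1 1), A.1 0 1)
  map_add' A B := by simp
  map_smul' c A := by simp
  invFun x := mkVec x.1 x.2.1 x.2.2
  left_inv A := by
    obtain ⟨a, d, y, rfl⟩ := exists_eq_mkVec A
    have h₀ : re ((mkVec a d y).1 0 0) = a := by simp [mkVec, re_one]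
    have h₁ : re ((mkVec a d y).1 1 1) = d := by simp [mkVec, re_one]
    change mkVec (re ((mkVec a d y).1 0 0)) (re ((mkVec a d y).1 1 1)) y = _
    rw [h₀, h₁]
  right_inv x := by simp [mkVec, re_one]

theorem finrank_vec : Module.finrank ℝ (Vec K) = Module.finrank ℝ K + 2 := by
  rw [(vecEquiv K).finrank_eq, Module.finrank_prod, Module.finrank_prod, Module.finrank_self]
  ring

end Superstring

open NormedDivisionAlgebra Superstring LInfinityData in
theorem mainTheorem2 (n : ℕ) (hn : n = 1 ∨ n = 2 ∨ n = 4 ∨ n = 8) :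
    (∃ (K : Type) (_ : NormedDivisionAlgebra K), Module.finrank ℝ K = n) ∧
    ∀ (K : Type*) [NormedDivisionAlgebra K], Module.finrank ℝ K = n →
      Module.finrank ℝ (Vec K) = n + 2 ∧
      (∀ (ψ φ : Spinor K) (A : Vec K), minkowski (spinorDot ψ φ) A = pairing ψ (gamma A φ)) ∧
      IsLieSuperalgebra (sisoGrading K) (sisoBracket K) ∧
      IsEvenCocycle (sisoGrading K) (sisoBracket K) (alpha K) ∧
      ¬ IsCoboundary (sisoGrading K) (sisoBracket K) (alpha K) ∧
      IsLieNSuperalgebra 2 bLine ∧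
      IsLieNSuperalgebra 2 (superstring K) ∧
      IsLieNSuperalgebra 2 (lieLInfinity (sisoGrading K) (sisoBracket K)) ∧
      IsShortExact bLine (superstring K) (lieLInfinity (sisoGrading K) (sisoBracket K))
        (LinearMap.inr ℝ (Siso K) ℝ) (LinearMap.fst ℝ (Siso K) ℝ) ∧
      ¬ IsExact 1 (superstring K) := by
  refine ⟨exists_normedDivisionAlgebra hn, fun K _ hK => ⟨?_, minkowski_spinorDot,
    isLieSuperalgebra_siso, isEvenCocycle_alpha, not_isCoboundary_alpha, isLieNSuperalgebra_bLine,
    isEvenCocycle_alpha.isLieNSuperalgebra_cocycleExtension isLieSuperalgebra_siso,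
    isLieSuperalgebra_siso.isLieNSuperalgebra_lieLInfinity, isShortExact_cocycleExtension _ _ _,
    fun h => not_isCoboundary_alpha (isCoboundary_of_isExact_cocycleExtension h)⟩⟩
  rw [finrank_vec, hK]
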